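/- All graphs are finite, undirected and simple, and $n=|V(G)|$ denotes the number of vertices of the input graph. A \emph{colored graph} is a pair $(G,c)$ of a graph $G$ and a (not necessarily proper) coloring $c\colon V(G)\to\mathbb{N}$; a \emph{property of colored graphs} $\Pi$ is a property of such pairs that is invariant under color-preserving isomorphism. For $U\subseteq V(G)$ let $N_G(U)$ be the set of vertices outside $U$ that have a neighbor in $U$; $U$ is \emph{$t$-secluded} if $|N_G(U)|\le t$. \textsc{Connected Secluded Colored $\Pi$-Subgraph of Exact Size} is the following problem. Given a graph $G$, a coloring $c\colon V(G)\to\mathbb{N}$, a weight function $\omega\colon V(G)\to\mathbb{Z}_{\ge 0}$ and nonnegative integers $k,t,w$, decide whether there is a $t$-secluded set $U\subseteq V(G)$ with $|U|=k$ and $\sum_{v\in U}\omega(v)\ge w$ such that the induced subgraph $G[U]$ is connected (in particular nonempty) and $(G[U],c|_U)$ satisfies $\Pi$. Running times are numbers of steps of a uniform-cost random access machine on natural numbers, with addition, truncated subtraction and indirect addressing; graphs are given by their adjacency matrices, and every color, every weight and each of $n,k,t,w$ occupies one memory cell. $\Pi$ \emph{can be recognized in time $f(n)$} if some program decides, for every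 $n$ and every colored graph on $n$ vertices, in at most $f(n)$ steps whether it satisfies $\Pi$. \textbf{Theorem.} There is an absolute constant $C$ such that the following holds. Let $\Pi$ be a property of colored graphs that can be recognized in time $f(n)$. Then \textsc{Connected Secluded Colored $\Pi$-Subgraph of Exact Size} can be solved in time $2^{k+t}\cdot f(k)\cdot n^{\mathcal{O}(1)}$, and it can also be solved in time $2^{\mathcal{O}(\min\{k,t\}\log(k+t))}\cdot f(k)\cdot n^{\mathcal{O}(1)}$. More precisely, there are a real number $A$ (which may depend on $\Pi$ and $f$, but not on the instance) and programs that solve every instance in at most $$A\cdot 2^{k+t}\cdot f(k)\cdot (n+1)^{C}\qquad\text{and}\qquad A\cdot 2^{C\min\{k,t\}\log(k+t)}\cdot f(k)\cdot (n+1)^{C}$$ steps, respectively, where the exponent $C\min\{k,t\}\log(k+t)$ is read as $0$ if $\min\{k,t\}=0$. -/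

import Mathlib

/-! ### The machine model: uniform-cost random access machines

A program is a structured program over a fixed finite set of registers and a fixed finite set of
arrays; registers and array cells hold natural numbers.  The arithmetic is addition and (truncated)
subtraction, array cells are accessed by computed index.  Every elementary operation has cost one.
There is deliberately no multiplication, so that the model is polynomially equivalent to Turing
machines. -/

/-- A memory configuration: the contents of the registers and of the arrays. -/
structure RamState where
  reg : ℕ → ℕ
  arr : ℕ → ℕ → ℕ

/-- Expressions: constants, registers, sum, truncated difference, array look-up. -/
inductive RamExpr : Type
  | lit (c : ℕ) : RamExpr
  | var (x : ℕ) : RamExpr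
  | add (e₁ e₂ : RamExpr) : RamExpr
  | sub (e₁ e₂ : RamExpr) : RamExpr
  | get (a : ℕ) (e : RamExpr) : RamExpr

namespace RamExpr

/-- The value of an expression. -/
def eval (s : RamState) : RamExpr → ℕ
  | lit c => c
  | var x => s.reg x
  | add e₁ e₂ => e₁.eval s + e₂.eval s
  | sub e₁ e₂ => e₁.eval s - e₂.eval s
  | get a e => s.arr a (e.eval s)

/-- The cost of evaluating an expression: one for each of its operations, constants and
registers. -/
def cost : RamExpr → ℕ
  | lit _ => 1
  | var _ => 1
  | add e₁ e₂ => e₁.cost + e₂.cost + 1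
  | sub e₁ e₂ => e₁.cost + e₂.cost + 1
  | get _ e => e.cost + 1

end RamExpr

/-- Programs: `assign x e` is `x := e`, `store a i e` is `a[i] := e`, `cond e p q` is
`if e ≠ 0 then p else q`, and `loop e p` is `while e ≠ 0 do p`. -/
inductive RamProg : Type
  | skip : RamProg
  | assign (x : ℕ) (e : RamExpr) : RamProg
  | store (a : ℕ) (i e : RamExpr) : RamProg
  | seq (p q : RamProg) : RamProg
  | cond (e : RamExpr) (p q : RamProg) : RamProg
  | loop (e : RamExpr) (p : RamProg) : RamProg

/-- `RamExec p s s' m`: started in memory configuration `s`, the program `p` halts after exactly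
`m` steps in memory configuration `s'`. -/
inductive RamExec : RamProg → RamState → RamState → ℕ → Prop
  | skip (s : RamState) : RamExec .skip s s 1
  | assign (s : RamState) (x : ℕ) (e : RamExpr) :
      RamExec (.assign x e) s { s with reg := Function.update s.reg x (e.eval s) } (e.cost + 1)
  | store (s : RamState) (a : ℕ) (i e : RamExpr) :
      RamExec (.store a i e) s
        { s with arr := Function.update s.arr a (Function.update (s.arr a) (i.eval s) (e.eval s)) }
        (i.cost + e.cost + 1)
  | seq {p q : RamProg} {s s' s'' : RamState} {m m' : ℕ} :
      RamExec p s s' m → RamExec q s' s'' m' → RamExec (.seq p q) s s'' (m + m')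
  | cond_true {e : RamExpr} {p q : RamProg} {s s' : RamState} {m : ℕ} :
      e.eval s ≠ 0 → RamExec p s s' m → RamExec (.cond e p q) s s' (e.cost + 1 + m)
  | cond_false {e : RamExpr} {p q : RamProg} {s s' : RamState} {m : ℕ} :
      e.eval s = 0 → RamExec q s s' m → RamExec (.cond e p q) s s' (e.cost + 1 + m)
  | loop_false {e : RamExpr} {p : RamProg} {s : RamState} :
      e.eval s = 0 → RamExec (.loop e p) s s (e.cost + 1)
  | loop_true {e : RamExpr} {p : RamProg} {s s' s'' : RamState} {m m' : ℕ} :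
      e.eval s ≠ 0 → RamExec p s s' m → RamExec (.loop e p) s' s'' m' →
      RamExec (.loop e p) s s'' (e.cost + 1 + m + m')

/-- The decision problem `L` on inputs `x : α`, given to the machine in the form `enc x`, is solved
within time `T x`: a single program halts on every input `x` after at most `T x` steps, and then
register `0` is nonzero exactly if `x` is a yes-instance. -/
def RamDecidableInTime {α : Type} (enc : α → RamState) (L : α → Prop) (T : α → ℝ) : Prop :=
  ∃ p : RamProg, ∀ x : α, ∃ (s : RamState) (m : ℕ),
    RamExec p (enc x) s m ∧ (m : ℝ) ≤ T x ∧ (s.reg 0 ≠ 0 ↔ L x)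

/-! ### Encoding of graphs -/

/-- A function on the vertices `0, …, n - 1` as the contents of an array, padded by zeros. -/
def vertexArray {n : ℕ} (g : Fin n → ℕ) : ℕ → ℕ :=
  fun i => if h : i < n then g ⟨i, h⟩ else 0

open Classical in
/-- The adjacency matrix of a graph on `0, …, n - 1` as the contents of an array, row by row:
the entry `(u, v)` is in cell `u * n + v`, and the cells from `n * n` on are zero. -/
noncomputable def adjacencyArray {n : ℕ} (G : SimpleGraph (Fin n)) : ℕ → ℕ :=
  fun i => if ∃ u v : Fin n, G.Adj u v ∧ i = u.val * n + v.val then 1 else 0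

/-! ### Properties of colored graphs -/

/-- A property of colored finite graphs: a property of pairs `(G, c)`, where `c` is a (not
necessarily proper) coloring by natural numbers, that is invariant under isomorphism. -/
structure ColoredGraphProperty where
  holds : ∀ {V : Type} [Finite V], SimpleGraph V → (V → ℕ) → Prop
  iso_invariant : ∀ {V W : Type} [Finite V] [Finite W] {G : SimpleGraph V} {H : SimpleGraph W}
    {c : V → ℕ} {d : W → ℕ} (φ : G ≃g H), (∀ v, d (φ v) = c v) → holds G c → holds H d

/-- A colored graph on the vertices `0, …, n - 1`. -/
structure ColoredGraph where
  n : ℕ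
  G : SimpleGraph (Fin n)
  color : Fin n → ℕ

/-- The number of vertices is in register `0`, the adjacency matrix in array `0`, the coloring in
array `1`; everything else is zero. -/
noncomputable def ColoredGraph.encode (X : ColoredGraph) : RamState where
  reg x := if x = 0 then X.n else 0
  arr a := if a = 0 then adjacencyArray X.G else if a = 1 then vertexArray X.color else 0

/-- The property can be recognized in time `f n`, where `n` is the number of vertices. -/
def ColoredGraphProperty.RecognizableInTime (P : ColoredGraphProperty) (f : ℕ → ℝ) : Prop :=
  RamDecidableInTime ColoredGraph.encode (fun X => P.holds X.G X.color) (fun X => f X.n)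

/-! ### Connected Secluded Colored `P`-Subgraph of Exact Size -/

/-- The open neighborhood of a set of vertices. -/
def SimpleGraph.openNeighborhood {V : Type} (G : SimpleGraph V) (U : Set V) : Set V :=
  {v | v ∉ U ∧ ∃ u ∈ U, G.Adj u v}

/-- A set of vertices is `t`-secluded if it has at most `t` neighbors outside itself. -/
def SimpleGraph.IsSecluded {V : Type} (G : SimpleGraph V) (t : ℕ) (U : Set V) : Prop :=
  (G.openNeighborhood U).ncard ≤ t

/-- An instance: a graph with a coloring and a weight function, and the integers `k`, `t`, `w`. -/
structure SecludedInstance where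
  n : ℕ
  G : SimpleGraph (Fin n)
  color : Fin n → ℕ
  weight : Fin n → ℕ
  k : ℕ
  t : ℕ
  w : ℕ

/-- The numbers `n`, `k`, `t`, `w` are in registers `0`, `1`, `2`, `3`, the adjacency matrix is in
array `0`, the coloring in array `1`, the weights in array `2`; everything else is zero. -/
noncomputable def SecludedInstance.encode (I : SecludedInstance) : RamState where
  reg x := if x = 0 then I.n else if x = 1 then I.k else if x = 2 then I.t else
    if x = 3 then I.w else 0
  arr a := if a = 0 then adjacencyArray I.G else if a = 1 then vertexArray I.color else
    if a = 2 then vertexArray I.weight else 0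

/-- The yes-instances: some connected `t`-secluded set `U` of exactly `k` vertices has weight at
least `w`, and the subgraph induced by `U`, with the restricted coloring, has the property. -/
def SecludedInstance.IsYes (P : ColoredGraphProperty) (I : SecludedInstance) : Prop :=
  ∃ U : Finset (Fin I.n),
    (I.G.induce (U : Set (Fin I.n))).Connected ∧
    I.G.IsSecluded I.t (U : Set (Fin I.n)) ∧
    P.holds (I.G.induce (U : Set (Fin I.n))) (fun v => I.color v.val) ∧
    U.card = I.k ∧
    I.w ≤ ∑ v ∈ U, I.weight v

/-- Connected Secluded Colored `P`-Subgraph of Exact Size can be solved within time `T`. -/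
def SecludedSolvableInTime (P : ColoredGraphProperty) (T : SecludedInstance → ℝ) : Prop :=
  RamDecidableInTime SecludedInstance.encode (SecludedInstance.IsYes P) T

/-!
Solutions are found by branching.  Grow a connected set from a start vertex: as long as the set is
too small, pick a neighbor of it that has not been decided about, and either take it or forbid it.
A solution `U` that contains the start vertex is reached by taking exactly the vertices of `U`; then
`k - 1` vertices are taken, and the forbidden ones are neighbors of `U`, hence at most `t`.  So the
number of branches is at most `(k - 1 + t).choose (k - 1)`.  This is at most `2 ^ (k + t)`, and also
at most `(k + t) ^ min k t` (`choose_le_add_pow_min`), and therefore one program satisfies both time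
bounds.

To avoid recursion, the program runs through the ranks `r < (k - 1 + t).choose (k - 1)` of the
decision sequences and decodes each rank during the exploration, with a table of binomial
coefficients: `explore` is this procedure in mathematical terms, `exists_explore_eq` and
`SecludedInstance.isYes_iff` are its correctness.  Since `t` may be replaced by `min t n`, all tables
and loops other than the one over the ranks are polynomial in `n`.

The given program that recognizes the property is called once for every candidate.  It works on
registers and arrays of its own and expects them to be zero at the start, so each of its array
accesses for writing is logged, and the logged cells are zeroed after the call; this takes time
proportional to the running time of the call (`SecludedProgram.call_runs`).

Programs are verified by total-correctness statements `RamProg.Runs` with a time budget.  Registers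
`5` and `6` hold the start vertex and the rank, `7`, `8`, `9` the parameters of `explore`, `10` the
size of the set, `11` the current vertex, `12` and `13` loop counters, `14` and `18` sums, `15` the
answer, `16` the number of ranks, `17` the length of the log, `19` the width of the table of binomial
coefficients; array `7` lists the set, and array `9` is the log.
-/

/-! ### Running programs within a time budget -/

namespace RamState

/-- Overwrite a register. -/
def setReg (s : RamState) (x v : ℕ) : RamState :=
  { s with reg := Function.update s.reg x v }

/-- Overwrite an array cell. -/
def setArr (s : RamState) (a i v : ℕ) : RamState :=
  { s with arr := Function.update s.arr a (Function.update (s.arr a) i v) }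

@[simp] theorem setReg_reg (s : RamState) (x v y : ℕ) :
    (s.setReg x v).reg y = if y = x then v else s.reg y := by
  simp [setReg, Function.update_apply]

@[simp] theorem setReg_arr (s : RamState) (x v : ℕ) : (s.setReg x v).arr = s.arr := rfl

@[simp] theorem setArr_reg (s : RamState) (a i v : ℕ) : (s.setArr a i v).reg = s.reg := rfl

@[simp] theorem setArr_arr (s : RamState) (a i v b : ℕ) :
    (s.setArr a i v).arr b = if b = a then Function.update (s.arr a) i v else s.arr b := by
  simp [setArr, Function.update_apply]

end RamState

theorem RamExpr.one_le_cost (e : RamExpr) : 1 ≤ e.cost := by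
  cases e <;> simp [RamExpr.cost]

namespace RamProg

/-- `p.Runs s T Q`: started in `s`, the program `p` halts after at most `T` steps, in a memory
configuration that satisfies `Q`. -/
def Runs (p : RamProg) (s : RamState) (T : ℕ) (Q : RamState → Prop) : Prop :=
  ∃ s' m, RamExec p s s' m ∧ m ≤ T ∧ Q s'

/-- The register `x` is assigned to somewhere in the program. -/
def ModReg : RamProg → ℕ → Prop
  | skip, _ => False
  | assign y _, x => x = y
  | store _ _ _, _ => False
  | seq p q, x => p.ModReg x ∨ q.ModReg x
  | cond _ p q, x => p.ModReg x ∨ q.ModReg x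
  | loop _ p, x => p.ModReg x

/-- Some cell of the array `a` is assigned to somewhere in the program. -/
def ModArr : RamProg → ℕ → Prop
  | skip, _ => False
  | assign _ _, _ => False
  | store b _ _, a => a = b
  | seq p q, a => p.ModArr a ∨ q.ModArr a
  | cond _ p q, a => p.ModArr a ∨ q.ModArr a
  | loop _ p, a => p.ModArr a

theorem reg_eq_of_exec {p : RamProg} {s s' : RamState} {m : ℕ} (h : RamExec p s s' m) {x : ℕ}
    (hx : ¬ p.ModReg x) : s'.reg x = s.reg x := by
  induction h <;> simp_all [ModReg]

theorem arr_eq_of_exec {p : RamProg} {s s' : RamState} {m : ℕ} (h : RamExec p s s' m) {a : ℕ}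
    (ha : ¬ p.ModArr a) : s'.arr a = s.arr a := by
  induction h <;> simp_all [ModArr]

theorem Runs.mono {p : RamProg} {s : RamState} {T T' : ℕ} {Q Q' : RamState → Prop}
    (h : p.Runs s T Q) (hT : T ≤ T') (hQ : ∀ s', Q s' → Q' s') : p.Runs s T' Q' := by
  obtain ⟨s', m, h1, h2, h3⟩ := h
  exact ⟨s', m, h1, h2.trans hT, hQ _ h3⟩

/-- A program changes only the registers and arrays that it assigns to. -/
theorem Runs.frame {p : RamProg} {s : RamState} {T : ℕ} {Q : RamState → Prop}
    (h : p.Runs s T Q) : p.Runs s T (fun s' => Q s' ∧ (∀ x, ¬ p.ModReg x → s'.reg x = s.reg x) ∧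
      ∀ a, ¬ p.ModArr a → s'.arr a = s.arr a) := by
  obtain ⟨s', m, h1, h2, h3⟩ := h
  exact ⟨s', m, h1, h2, h3, fun x hx => reg_eq_of_exec h1 hx, fun x hx => arr_eq_of_exec h1 hx⟩

theorem Runs.seq {p q : RamProg} {s : RamState} {T T₁ : ℕ} {Q Q₁ : RamState → Prop}
    (hp : p.Runs s T₁ Q₁) (hT : T₁ ≤ T) (hq : ∀ s', Q₁ s' → q.Runs s' (T - T₁) Q) :
    (p.seq q).Runs s T Q := by
  obtain ⟨s', m, h1, h2, h3⟩ := hp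
  obtain ⟨s'', m', h4, h5, h6⟩ := hq _ h3
  exact ⟨s'', m + m', h1.seq h4, by omega, h6⟩

/-- `Runs.seq`, with the knowledge of what the first program leaves unchanged. -/
theorem Runs.seqFrame {p q : RamProg} {s : RamState} {T T₁ : ℕ} {Q Q₁ : RamState → Prop}
    (hp : p.Runs s T₁ Q₁) (hT : T₁ ≤ T)
    (hq : ∀ s', Q₁ s' → (∀ x, ¬ p.ModReg x → s'.reg x = s.reg x) →
      (∀ a, ¬ p.ModArr a → s'.arr a = s.arr a) → q.Runs s' (T - T₁) Q) :
    (p.seq q).Runs s T Q :=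
  hp.frame.seq hT fun s' h => hq s' h.1 h.2.1 h.2.2

theorem Runs.cond {e : RamExpr} {p q : RamProg} {s : RamState} {T : ℕ} {Q : RamState → Prop}
    (hT : e.cost + 1 ≤ T) (hp : e.eval s ≠ 0 → p.Runs s (T - (e.cost + 1)) Q)
    (hq : e.eval s = 0 → q.Runs s (T - (e.cost + 1)) Q) : (RamProg.cond e p q).Runs s T Q := by
  by_cases h : e.eval s = 0
  · obtain ⟨s', m, h1, h2, h3⟩ := hq h
    exact ⟨s', _, .cond_false h h1, by omega, h3⟩
  · obtain ⟨s', m, h1, h2, h3⟩ := hp h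
    exact ⟨s', _, .cond_true h h1, by omega, h3⟩

/-- The program contains no loop. -/
def LoopFree : RamProg → Bool
  | skip => true
  | assign _ _ => true
  | store _ _ _ => true
  | seq p q => p.LoopFree && q.LoopFree
  | cond _ p q => p.LoopFree && q.LoopFree
  | loop _ _ => false

/-- The memory configuration that a loop-free program ends in; loops are ignored. -/
def exec : RamProg → RamState → RamState
  | skip, s => s
  | assign x e, s => s.setReg x (e.eval s)
  | store a i e, s => s.setArr a (i.eval s) (e.eval s)
  | seq p q, s => q.exec (p.exec s)
  | cond e p q, s => if e.eval s ≠ 0 then p.exec s else q.exec s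
  | loop _ _, s => s

/-- An upper bound for the number of steps of a loop-free program. -/
def maxCost : RamProg → ℕ
  | skip => 1
  | assign _ e => e.cost + 1
  | store _ i e => i.cost + e.cost + 1
  | seq p q => p.maxCost + q.maxCost
  | cond e p q => e.cost + 1 + (p.maxCost + q.maxCost)
  | loop _ _ => 0

theorem exec_runs {p : RamProg} (hp : p.LoopFree = true) (s : RamState) :
    p.Runs s p.maxCost (· = p.exec s) := by
  induction p generalizing s with
  | skip => exact ⟨_, _, .skip s, le_rfl, rfl⟩
  | assign x e => exact ⟨_, _, .assign s x e, le_rfl, rfl⟩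
  | store a i e => exact ⟨_, _, .store s a i e, le_rfl, rfl⟩
  | seq p q ihp ihq =>
    simp only [LoopFree, Bool.and_eq_true] at hp
    refine (ihp hp.1 s).seq (by simp [maxCost]) fun s' h => ?_
    subst h
    exact (ihq hp.2 _).mono (by simp [maxCost]) fun s' h => h
  | cond e p q ihp ihq =>
    simp only [LoopFree, Bool.and_eq_true] at hp
    refine Runs.cond (by simp [maxCost]) (fun h => ?_) (fun h => ?_)
    · exact (ihp hp.1 s).mono (by simp [maxCost]) fun s' h' => by simp [exec, h, h']
    · exact (ihq hp.2 s).mono (by simp [maxCost]) fun s' h' => by simp [exec, h, h']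
  | loop e p => simp [LoopFree] at hp

theorem Runs.of_exec {p : RamProg} {s : RamState} {T : ℕ} {Q : RamState → Prop}
    (hp : p.LoopFree = true) (hT : p.maxCost ≤ T) (h : Q (p.exec s)) : p.Runs s T Q :=
  (exec_runs hp s).mono hT fun _ h' => h' ▸ h

theorem Runs.seqExec {p q : RamProg} {s : RamState} {T : ℕ} {Q : RamState → Prop}
    (hp : p.LoopFree = true) (hT : p.maxCost ≤ T) (hq : q.Runs (p.exec s) (T - p.maxCost) Q) :
    (p.seq q).Runs s T Q :=
  (exec_runs hp s).seq hT fun _ h => h ▸ hq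

/-- Total correctness of a loop by an invariant with a decreasing natural-valued measure. -/
theorem Runs.loop {e : RamExpr} {p : RamProg} {B : ℕ} {Inv : ℕ → RamState → Prop}
    (h : ∀ j s, Inv j s → e.eval s ≠ 0 → p.Runs s B (fun s' => ∃ j' < j, Inv j' s'))
    (j : ℕ) : ∀ s, Inv j s →
    (loop e p).Runs s (j * (e.cost + 1 + B) + (e.cost + 1))
      (fun s' => e.eval s' = 0 ∧ ∃ j', Inv j' s') := by
  induction j using Nat.strong_induction_on with
  | _ j ih =>
    intro s hs
    by_cases he : e.eval s = 0
    · exact ⟨s, _, .loop_false he, by omega, he, j, hs⟩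
    · obtain ⟨s', m, h1, h2, j', hj, h3⟩ := h j s hs he
      obtain ⟨s'', m', h4, h5, h6⟩ := ih j' hj s' h3
      refine ⟨s'', _, .loop_true he h1 h4, ?_, h6⟩
      have : (j' + 1) * (e.cost + 1 + B) ≤ j * (e.cost + 1 + B) := Nat.mul_le_mul_right _ hj
      rw [Nat.add_mul] at this
      omega

/-- `for i < b do body`, where `i` and `b` are registers; `body` must change neither. -/
def forLoop (i b : ℕ) (body : RamProg) : RamProg :=
  .seq (.assign i (.lit 0)) (.loop (.sub (.var b) (.var i))
    (.seq body (.assign i (.add (.var i) (.lit 1)))))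

@[simp] theorem modReg_forLoop {i b : ℕ} {body : RamProg} {x : ℕ} :
    (forLoop i b body).ModReg x ↔ x = i ∨ body.ModReg x := by
  simp only [forLoop, ModReg]; tauto

@[simp] theorem modArr_forLoop {i b : ℕ} {body : RamProg} {a : ℕ} :
    (forLoop i b body).ModArr a ↔ body.ModArr a := by
  simp only [forLoop, ModArr]; tauto

/-- The invariant rule for `forLoop`: the invariant `Inv j` holds when the counter has been set
to `j`, and `N` is the number of rounds. -/
theorem Runs.forLoop {i b : ℕ} {body : RamProg} {B N T : ℕ} {Inv : ℕ → RamState → Prop}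
    {s : RamState} (hT : N * (B + 8) + 6 ≤ T) (hib : i ≠ b) (hi : ¬ body.ModReg i)
    (hb : ¬ body.ModReg b) (hN : s.reg b = N)
    (h0 : Inv 0 (s.setReg i 0))
    (h : ∀ j s', j < N → Inv j s' → s'.reg i = j → s'.reg b = N →
      (∀ x, x ≠ i → ¬ body.ModReg x → s'.reg x = s.reg x) →
      (∀ a, ¬ body.ModArr a → s'.arr a = s.arr a) →
      body.Runs s' B (fun s'' => Inv (j + 1) (s''.setReg i (j + 1)))) :
    (RamProg.forLoop i b body).Runs s T (Inv N) := by
  refine Runs.seqExec rfl (by simp [maxCost, RamExpr.cost]; omega) ?_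
  simp only [exec, RamExpr.eval]
  refine (Runs.loop (B := B + 4) (Inv := fun m s' => ∃ j, j + m = N ∧ Inv j s' ∧ s'.reg i = j ∧
    s'.reg b = N ∧ (∀ x, x ≠ i → ¬ body.ModReg x → s'.reg x = s.reg x) ∧
    (∀ a, ¬ body.ModArr a → s'.arr a = s.arr a)) ?_ N _ ?_).mono ?_ ?_
  · rintro m s' ⟨j, hj, hInv, hsi, hsb, hf, hg⟩ he
    simp only [RamExpr.eval, hsi, hsb] at he
    refine Runs.seqFrame (h j s' (by omega) hInv hsi hsb hf hg) (by omega) ?_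
    intro s'' hQ hf' hg'
    refine Runs.of_exec rfl (by simp [maxCost, RamExpr.cost]) ⟨m - 1, by omega, j + 1, by omega, ?_⟩
    have hi' : s''.reg i = j := (hf' i hi).trans hsi
    simp only [exec, RamExpr.eval, hi']
    refine ⟨hQ, by simp, ?_, ?_, ?_⟩
    · simp [hib.symm, hf' b hb, hsb]
    · intro x hx hx'
      simp [hx, hf' x hx', hf x hx hx']
    · intro a ha
      simp [hg' a ha, hg a ha]
  · exact ⟨0, by omega, h0, by simp, by simp [hib.symm, hN], fun x hx _ => by simp [hx], by simp⟩
  · simp only [RamExpr.cost, maxCost]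
    have : N * (1 + 1 + 1 + 1 + (B + 4)) = N * (B + 8) := by ring
    omega
  · rintro s' ⟨he, m, j, hj, hInv, hsi, hsb, -⟩
    simp only [RamExpr.eval, hsi, hsb] at he
    have : j = N := by omega
    exact this ▸ hInv

end RamProg

/-! ### Exploring connected vertex sets -/

section Explore

variable {n : ℕ} (G : SimpleGraph (Fin n))

open Classical in
/-- The undecided neighbors of the vertices in `l`: those that are neither in `l` nor in the set
`F` of forbidden vertices. -/
noncomputable def candidates (l : List (Fin n)) (F : Finset (Fin n)) : Finset (Fin n) :=
  Finset.univ.filter fun y => y ∉ l ∧ y ∉ F ∧ ∃ u ∈ l, G.Adj u y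

open Classical in
/-- Grow the vertex set `l`: while there is an undecided neighbor, decide about the largest one,
`a` more times by taking it and at most `b` times by forbidding it.  The number `r` encodes the
sequence of decisions, as its rank among the `(a + b).choose a` sequences in the order in which
taking comes before forbidding. -/
noncomputable def explore (a b r : ℕ) (l : List (Fin n)) (F : Finset (Fin n)) : List (Fin n) :=
  match a with
  | 0 => l
  | a + 1 =>
    if h : (candidates G l F).Nonempty then
      if r < (a + b).choose a then explore a b r (l ++ [(candidates G l F).max' h]) F
      else match b with
        | 0 => l
        | b + 1 =>
          explore (a + 1) b (r - (a + (b + 1)).choose a) l (insert ((candidates G l F).max' h) F)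
    else l
termination_by a + b

variable {G}

theorem mem_candidates {l : List (Fin n)} {F : Finset (Fin n)} {y : Fin n} :
    y ∈ candidates G l F ↔ y ∉ l ∧ y ∉ F ∧ ∃ u ∈ l, G.Adj u y := by
  simp [candidates]

/-- What holds for a list of vertices and survives appending a new neighbor holds for the outcome
of the exploration. -/
theorem explore_induction {p : List (Fin n) → Prop}
    (hp : ∀ l x, p l → x ∉ l → (∃ u ∈ l, G.Adj u x) → p (l ++ [x]))
    (a b r : ℕ) (l : List (Fin n)) (F : Finset (Fin n)) (hl : p l) : p (explore G a b r l F) := by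
  induction hm : a + b using Nat.strong_induction_on generalizing a b r l F with
  | _ m ih =>
    cases a with
    | zero => rw [explore]; exact hl
    | succ a =>
      rw [explore]
      split_ifs with h h'
      · have hx := mem_candidates.1 ((candidates G l F).max'_mem h)
        exact ih (a + b) (by omega) _ _ _ _ _ (hp _ _ hl hx.1 hx.2.2) rfl
      · cases b with
        | zero => exact hl
        | succ b => exact ih (a + 1 + b) (by omega) _ _ _ _ _ hl rfl
      · exact hl

theorem nodup_explore (a b r : ℕ) {l : List (Fin n)} (F : Finset (Fin n)) (hl : l.Nodup) :
    (explore G a b r l F).Nodup :=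
  explore_induction (p := List.Nodup)
    (fun l x h hx _ => by simpa [List.nodup_append, h] using fun y hy => ne_of_mem_of_not_mem hy hx)
    a b r l F hl

theorem connected_explore (a b r : ℕ) {l : List (Fin n)} (F : Finset (Fin n))
    (hl : (G.induce {v | v ∈ l}).Connected) :
    (G.induce {v | v ∈ explore G a b r l F}).Connected := by
  refine explore_induction (p := fun l => (G.induce {v | v ∈ l}).Connected)
    (fun l x h hx ⟨u, hu, hux⟩ => ?_) a b r l F hl
  have := SimpleGraph.connected_induce_union (G := G) (t := {x}) h.preconnected .of_subsingleton
    hu rfl hux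
  rwa [show {v | v ∈ l ++ [x]} = {v | v ∈ l} ∪ {x} by ext; simp [or_comm]]

/-- Every connected set is the outcome of some exploration: if `T` has `a` vertices outside `l` and
at most `b` neighbors outside `F`, then some rank below `(a + b).choose a` leads to `T`. -/
theorem exists_explore_eq {T : Finset (Fin n)} (hT : (G.induce (T : Set (Fin n))).Connected)
    (a b : ℕ) (l : List (Fin n)) (F : Finset (Fin n)) (hne : l ≠ []) (hl : l.Nodup)
    (hlT : ∀ x ∈ l, x ∈ T) (hF : (F : Set (Fin n)) ⊆ G.openNeighborhood (T : Set (Fin n)))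
    (hb : (G.openNeighborhood (T : Set (Fin n))).ncard ≤ b + F.card)
    (ha : T.card = l.length + a) :
    ∃ r < (a + b).choose a, (explore G a b r l F).toFinset = T := by
  induction hm : a + b using Nat.strong_induction_on generalizing a b l F with
  | _ m ih =>
    have hsub : l.toFinset ⊆ T := fun x hx => hlT x (List.mem_toFinset.1 hx)
    have hcard : l.toFinset.card = l.length := List.toFinset_card_of_nodup hl
    cases a with
    | zero =>
      refine ⟨0, by simp, ?_⟩
      rw [explore]
      exact Finset.eq_of_subset_of_card_le hsub (by omega)
    | succ a =>
      -- `T` is connected and larger than `l`, so that a walk inside `T` leaves `l`.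
      have hcand : (candidates G l F).Nonempty := by
        obtain ⟨y, hyT, hyl⟩ : ∃ y ∈ T, y ∉ l.toFinset := by
          by_contra! hcon
          have := Finset.card_le_card (show T ⊆ l.toFinset from hcon)
          omega
        obtain ⟨u, hu⟩ := List.exists_mem_of_ne_nil l hne
        obtain ⟨w⟩ := hT.preconnected ⟨u, hlT u hu⟩ ⟨y, hyT⟩
        obtain ⟨d, -, hd1, hd2⟩ := w.exists_boundary_dart {z | z.1 ∈ l} hu
          (by simpa using hyl)
        refine ⟨d.snd.1, mem_candidates.2 ⟨hd2, fun hdF => ?_, d.fst.1, hd1, d.adj⟩⟩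
        exact (hF hdF).1 d.snd.2
      set x := (candidates G l F).max' hcand with hx
      have hxm := mem_candidates.1 ((candidates G l F).max'_mem hcand)
      rw [← hx] at hxm
      obtain ⟨hxl, hxF, u, hul, hux⟩ := hxm
      by_cases hxT : x ∈ T
      · obtain ⟨r, hr, hrT⟩ := ih (a + b) (by omega) a b (l ++ [x]) F (by simp)
          (by simpa [List.nodup_append, hl] using fun y hy => ne_of_mem_of_not_mem hy hxl)
          (by simpa [or_imp, forall_and, hxT] using hlT) hF hb (by simp; omega) rfl
        refine ⟨r, hr.trans_le (hm ▸ ?_), ?_⟩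
        · rw [show a + 1 + b = a + b + 1 by ring, Nat.choose_succ_succ]
          omega
        · rw [explore, dif_pos hcand, if_pos hr]
          exact hrT
      -- Otherwise `x` is a neighbor of `T`; it is forbidden, and the ranks of the sequences that
      -- begin in this way are shifted by the number of those that begin with taking `x`.
      · have hxN : x ∈ G.openNeighborhood (T : Set (Fin n)) :=
          ⟨hxT, u, hlT u hul, hux⟩
        have hF' : ((insert x F : Finset (Fin n)) : Set (Fin n)) ⊆
            G.openNeighborhood (T : Set (Fin n)) := by
          simpa [Set.insert_subset_iff, hxN] using hF
        have hlt : (insert x F).card ≤ (G.openNeighborhood (T : Set (Fin n))).ncard := by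
          rw [← Set.ncard_coe_finset]
          exact Set.ncard_le_ncard hF' (Set.toFinite _)
        rw [Finset.card_insert_of_notMem hxF] at hlt
        obtain ⟨b, rfl⟩ : ∃ b', b = b' + 1 := ⟨b - 1, by omega⟩
        obtain ⟨r, hr, hrT⟩ := ih (a + 1 + b) (by omega) (a + 1) b l (insert x F) hne hl hlT hF'
          (by rw [Finset.card_insert_of_notMem hxF]; omega) ha rfl
        refine ⟨r + (a + (b + 1)).choose a, hm ▸ ?_, ?_⟩
        · rw [show a + 1 + (b + 1) = a + (b + 1) + 1 by ring, Nat.choose_succ_succ']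
          rw [show a + 1 + b = a + (b + 1) by ring] at hr
          omega
        · rw [explore, dif_pos hcand, if_neg (by omega)]
          simpa using hrT

end Explore

/-! ### The instance in terms of explorations -/

/-- The colored graph that is induced by a list of vertices, on the positions of the list. -/
def listColoredGraph {n : ℕ} (G : SimpleGraph (Fin n)) (c : Fin n → ℕ) (l : List (Fin n)) :
    ColoredGraph :=
  ⟨l.length, G.comap l.get, fun i => c (l.get i)⟩

theorem holds_listColoredGraph_iff (P : ColoredGraphProperty) {n : ℕ} (G : SimpleGraph (Fin n))
    (c : Fin n → ℕ) {l : List (Fin n)} (hl : l.Nodup) (U : Finset (Fin n)) (hU : l.toFinset = U) :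
    P.holds (listColoredGraph G c l).G (listColoredGraph G c l).color ↔
      P.holds (G.induce (U : Set (Fin n))) (fun v => c v.val) := by
  let e : Fin l.length ≃ (U : Set (Fin n)) :=
    (List.Nodup.getEquiv l hl).trans (Equiv.subtypeEquivRight fun x => by simp [← hU])
  let φ : (listColoredGraph G c l).G ≃g G.induce (U : Set (Fin n)) :=
    { toEquiv := e, map_rel_iff' := fun {a b} => Iff.rfl }
  exact ⟨P.iso_invariant φ fun _ => rfl, P.iso_invariant φ.symm fun v => by
    obtain ⟨i, rfl⟩ := e.surjective v
    exact congrArg (fun j => c (l.get j)) (e.symm_apply_apply i)⟩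

namespace SecludedInstance

variable (P : ColoredGraphProperty) (I : SecludedInstance)

/-- The list `l` of vertices has the right size, boundary and weight, and the property holds. -/
def Good (l : List (Fin I.n)) : Prop :=
  l.length = I.k ∧ {y | y ∉ l ∧ ∃ u ∈ l, I.G.Adj u y}.ncard ≤ I.t ∧
    I.w ≤ (l.map I.weight).sum ∧
    P.holds (listColoredGraph I.G I.color l).G (listColoredGraph I.G I.color l).color

/-- The vertex set found by the exploration from `v` with rank `r`.  At most `I.n` vertices can be
forbidden, so that a larger bound on the size of the neighborhood is lowered to `I.n`. -/
noncomputable def found (v : Fin I.n) (r : ℕ) : List (Fin I.n) :=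
  explore I.G (I.k - 1) (min I.t I.n) r [v] ∅

/-- The problem is decided by trying all explorations: their outcomes are connected, and every
solution is among them. -/
theorem isYes_iff (hk : 1 ≤ I.k) :
    I.IsYes P ↔ ∃ v : Fin I.n, ∃ r < (I.k - 1 + min I.t I.n).choose (I.k - 1),
      I.Good P (I.found v r) := by
  have key (l : List (Fin I.n)) (U : Finset (Fin I.n)) (hU : l.toFinset = U) (hl : l.Nodup) :
      I.Good P l ↔ I.G.IsSecluded I.t (U : Set (Fin I.n)) ∧
        P.holds (I.G.induce (U : Set (Fin I.n))) (fun v => I.color v.val) ∧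
        U.card = I.k ∧ I.w ≤ ∑ v ∈ U, I.weight v := by
    rw [← holds_listColoredGraph_iff P I.G I.color hl U hU, ← hU, List.toFinset_card_of_nodup hl,
      List.sum_toFinset _ hl]
    simp only [Good, SimpleGraph.IsSecluded, SimpleGraph.openNeighborhood, List.coe_toFinset,
      Set.mem_ofPred_eq]
    tauto
  constructor
  · rintro ⟨U, hc, hU⟩
    obtain ⟨v, hv⟩ := hc.nonempty
    have hle : (I.G.openNeighborhood (U : Set (Fin I.n))).ncard ≤ min I.t I.n :=
      le_min hU.1 ((Set.ncard_le_card _).trans (by simp))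
    obtain ⟨r, hr, h⟩ := exists_explore_eq hc (I.k - 1) (min I.t I.n) [v] ∅ (by simp) (by simp)
      (by simpa using hv) (by simp) (by simpa using hle) (by simp [hU.2.2.1]; omega)
    exact ⟨v, r, hr, (key _ _ h (nodup_explore _ _ _ _ (by simp))).2 hU⟩
  · rintro ⟨v, r, -, h⟩
    have hn : (I.found v r).Nodup := nodup_explore _ _ _ _ (by simp)
    refine ⟨_, ?_, (key _ _ rfl hn).1 h⟩
    rw [List.coe_toFinset]
    refine connected_explore _ _ _ _ ((SimpleGraph.connected_iff _).2
      ⟨@SimpleGraph.Preconnected.of_subsingleton _ _ ?_, ⟨v, List.mem_singleton_self v⟩⟩)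
    exact ⟨fun x y => Subtype.ext ((List.mem_singleton.1 x.2).trans
      (List.mem_singleton.1 y.2).symm)⟩

end SecludedInstance

/-! ### Contents of the input arrays -/

theorem mul_add_inj_of_lt {m a b c d : ℕ} (hb : b < m) (hd : d < m) :
    a * m + b = c * m + d ↔ a = c ∧ b = d := by
  constructor
  · intro h
    have hm : 0 < m := by omega
    have h1 := congrArg (· / m) h
    have h2 := congrArg (· % m) h
    simp only [Nat.add_comm (_ * m), Nat.add_mul_div_right _ _ hm,
      Nat.add_mul_mod_self_right, Nat.div_eq_of_lt hb, Nat.div_eq_of_lt hd, Nat.mod_eq_of_lt hb,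
      Nat.mod_eq_of_lt hd] at h1 h2
    omega
  · rintro ⟨rfl, rfl⟩; rfl

open Classical in
theorem adjacencyArray_apply {n : ℕ} (G : SimpleGraph (Fin n)) (u v : Fin n) :
    adjacencyArray G (u * n + v) = if G.Adj u v then 1 else 0 := by
  refine if_congr ⟨?_, fun h => ⟨u, v, h, rfl⟩⟩ rfl rfl
  rintro ⟨u', v', h, he⟩
  rw [mul_add_inj_of_lt v.2 v'.2] at he
  rwa [Fin.ext he.1, Fin.ext he.2]

theorem adjacencyArray_of_le {n : ℕ} (G : SimpleGraph (Fin n)) {i : ℕ} (hi : n * n ≤ i) :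
    adjacencyArray G i = 0 := by
  refine if_neg ?_
  rintro ⟨u, v, -, rfl⟩
  have : (u.val + 1) * n ≤ n * n := Nat.mul_le_mul_right _ u.2
  have := v.2
  rw [Nat.add_mul] at *
  omega

theorem vertexArray_apply {n : ℕ} (g : Fin n → ℕ) (v : Fin n) : vertexArray g v = g v := by
  simp [vertexArray]

theorem vertexArray_of_le {n : ℕ} (g : Fin n → ℕ) {i : ℕ} (hi : n ≤ i) : vertexArray g i = 0 := by
  simp [vertexArray, hi]

/-! ### The exploration as a program -/

namespace SecludedProgram

open RamProg

infixr:60 " ;; " => RamProg.seq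

/-- The data that stay fixed during the main part of the program: registers `0`, `1`, `2`, `3`
hold `n`, `k`, `t`, `w`, register `4` holds `min t n`; arrays `0`, `1`, `2` hold the adjacency
matrix, the colors and the weights, arrays `3` and `4` the multiples of `n` and of `k` (they are
used for addressing matrices), and array `8` the binomial coefficients. -/
structure Ctx (I : SecludedInstance) (s : RamState) : Prop where
  n : s.reg 0 = I.n
  k : s.reg 1 = I.k
  t : s.reg 2 = I.t
  w : s.reg 3 = I.w
  t' : s.reg 4 = min I.t I.n
  adj : s.arr 0 = adjacencyArray I.G
  color : s.arr 1 = vertexArray I.color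
  weight : s.arr 2 = vertexArray I.weight
  mulN : ∀ u < I.n, s.arr 3 u = u * I.n
  mulK : ∀ i < I.k, s.arr 4 i = i * I.k
  choose : ∀ a < I.k, ∀ b ≤ min I.t I.n, s.arr 8 (a * (I.n + 1) + b) = (a + b).choose a

theorem Ctx.congr {I : SecludedInstance} {s s' : RamState} (h : Ctx I s)
    (hr : ∀ x ≤ 4, s'.reg x = s.reg x) (ha : ∀ a ≤ 4, s'.arr a = s.arr a)
    (h8 : s'.arr 8 = s.arr 8) : Ctx I s' := by
  constructor <;> simp only [hr, ha, h8, Nat.reduceLeDiff, Nat.zero_le, h.n, h.k, h.t, h.w, h.t',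
    h.adj, h.color, h.weight]
  exacts [h.mulN, h.mulK, h.choose]

/-- The state of an exploration: array `7` and register `10` hold the list `l` of the vertices
taken; array `5` marks them by `2` and the forbidden ones by `1`; the cells of array `6` are
nonzero at the neighbors of `l`. -/
structure Exploring (I : SecludedInstance) (l : List (Fin I.n)) (F : Finset (Fin I.n))
    (s : RamState) : Prop where
  length : s.reg 10 = l.length
  list : ∀ (i : ℕ) (h : i < l.length), s.arr 7 i = l[i].val
  taken : ∀ y : Fin I.n, s.arr 5 y = 2 ↔ y ∈ l
  undecided : ∀ y : Fin I.n, s.arr 5 y = 0 ↔ y ∉ l ∧ y ∉ F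
  le_two : ∀ y : Fin I.n, s.arr 5 y ≤ 2
  marked : ∀ y : Fin I.n, s.arr 6 y ≠ 0 ↔ ∃ u ∈ l, I.G.Adj u y

theorem Exploring.congr {I : SecludedInstance} {l : List (Fin I.n)} {F : Finset (Fin I.n)}
    {s s' : RamState} (h : Exploring I l F s) (hr : s'.reg 10 = s.reg 10)
    (h5 : s'.arr 5 = s.arr 5) (h6 : s'.arr 6 = s.arr 6) (h7 : s'.arr 7 = s.arr 7) :
    Exploring I l F s' := by
  constructor <;> simp only [hr, h5, h6, h7]
  exacts [h.length, h.list, h.taken, h.undecided, h.le_two, h.marked]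

/-- Take the vertex in register `11`. -/
def takeVertex : RamProg :=
  (.store 5 (.var 11) (.lit 2) ;; .store 7 (.var 10) (.var 11) ;;
    .assign 10 (.add (.var 10) (.lit 1))) ;;
  forLoop 12 0 (.store 6 (.var 12)
    (.add (.get 6 (.var 12)) (.get 0 (.add (.get 3 (.var 11)) (.var 12)))))

theorem takeVertex_runs {I : SecludedInstance} {l : List (Fin I.n)} {F : Finset (Fin I.n)}
    {s : RamState} (hC : Ctx I s) (hS : Exploring I l F s) (x : Fin I.n) (hx : s.reg 11 = x) :
    takeVertex.Runs s (30 * (I.n + 1)) (Exploring I (l ++ [x]) F) := by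
  classical
  refine Runs.seqExec rfl (by simp [maxCost, RamExpr.cost]; omega) ?_
  simp only [exec, RamExpr.eval]
  refine ((Runs.forLoop (B := 10) (N := I.n) (Inv := fun j s' => ∀ y : Fin I.n, s'.arr 6 y =
    s.arr 6 y + if y < j ∧ I.G.Adj x y then 1 else 0) (by simp [maxCost, RamExpr.cost]; omega)
    (by simp) (by simp [ModReg]) (by simp [ModReg]) (by simp [hC.n]) (by simp) ?_).frame.mono
    le_rfl ?_)
  · intro j s' hj hInv hsi _ hf hg
    refine Runs.of_exec rfl (by simp [maxCost, RamExpr.cost]) fun y => ?_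
    have h0 := hg 0 (by simp [ModArr])
    have h3 := hg 3 (by simp [ModArr])
    have h11 := hf 11 (by simp) (by simp [ModReg])
    simp at h0 h3 h11
    have hxj := adjacencyArray_apply I.G x ⟨j, hj⟩
    simp only at hxj
    simp only [exec, RamExpr.eval, RamState.setReg_arr, RamState.setArr_arr, if_true, hsi, h0, h3,
      h11, hx, hC.mulN _ x.2, hC.adj, hxj, Function.update_apply]
    by_cases h1 : y.val = j
    · obtain rfl : y = ⟨j, hj⟩ := Fin.ext h1
      have := hInv ⟨j, hj⟩
      simp only [lt_irrefl, false_and, if_false] at this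
      simp [this]
    · have h2 : y.val < j + 1 ↔ y.val < j := by omega
      simp [h1, h2, hInv y]
  · rintro s' ⟨hInv, hf, hg⟩
    have h5 := hg 5 (by simp [ModArr])
    have h7 := hg 7 (by simp [ModArr])
    have h10 := hf 10 (by simp [ModReg])
    simp only [RamState.setReg_reg, RamState.setReg_arr, RamState.setArr_arr, RamState.setArr_reg,
      if_true, hx, hS.length] at h5 h7 h10
    simp only [Nat.reduceEqDiff, if_false] at h5 h7
    constructor
    · simp [h10]
    · intro i hi
      rw [h7, Function.update_apply]
      split_ifs with h
      · simp [h]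
      · have hi' : i < l.length := by simp at hi; omega
        rw [hS.list i hi', List.getElem_append_left hi']
    · intro y
      rw [h5, Function.update_apply, List.mem_append, List.mem_singleton, ← hS.taken, Fin.ext_iff]
      split_ifs with h <;> simp [h]
    · intro y
      rw [h5, Function.update_apply, List.mem_append, List.mem_singleton, Fin.ext_iff]
      split_ifs with h
      · simp [h]
      · rw [hS.undecided]; simp [h]
    · intro y
      rw [h5, Function.update_apply]
      split_ifs with h
      · rfl
      · exact hS.le_two y
    · intro y
      rw [hInv]
      have := hS.marked y
      simp only [y.2, true_and, List.mem_append, List.mem_singleton, or_and_right, exists_or,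
        exists_eq_left, ← this]
      split_ifs with h <;> simp [h]

/-- Set register `11` to the largest undecided neighbor, or to `n` if there is none. -/
def pickVertex : RamProg :=
  .assign 11 (.var 0) ;;
  forLoop 12 0 (.cond (.get 6 (.var 12)) (.cond (.get 5 (.var 12)) .skip (.assign 11 (.var 12)))
    .skip)

theorem pickVertex_runs {I : SecludedInstance} {l : List (Fin I.n)} {F : Finset (Fin I.n)}
    {s : RamState} (hC : Ctx I s) (hS : Exploring I l F s) :
    pickVertex.Runs s (30 * (I.n + 1)) (fun s' =>
      (candidates I.G l F = ∅ ∧ s'.reg 11 = I.n) ∨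
      ∃ h : (candidates I.G l F).Nonempty, s'.reg 11 = ((candidates I.G l F).max' h).val) := by
  refine Runs.seqExec rfl (by simp [maxCost, RamExpr.cost]; omega) ?_
  simp only [exec, RamExpr.eval]
  refine (Runs.forLoop (B := 12) (N := I.n) (Inv := fun j s' =>
    ((∀ y ∈ candidates I.G l F, j ≤ y.val) ∧ s'.reg 11 = I.n) ∨
    ∃ x ∈ candidates I.G l F, s'.reg 11 = x.val ∧ ∀ y ∈ candidates I.G l F, y.val < j → y ≤ x)
    (by simp [maxCost, RamExpr.cost]; omega) (by simp) (by simp [ModReg]) (by simp [ModReg])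
    (by simp [hC.n]) (by simp [hC.n]) ?_).mono le_rfl ?_
  · intro j s' hj hInv hsi _ hf hg
    refine Runs.of_exec rfl (by simp [maxCost, RamExpr.cost]) ?_
    have h5 := hg 5 (by simp [ModArr])
    have h6 := hg 6 (by simp [ModArr])
    simp only [RamState.setReg_arr] at h5 h6
    have hcand : (⟨j, hj⟩ : Fin I.n) ∈ candidates I.G l F ↔ s.arr 6 j ≠ 0 ∧ s.arr 5 j = 0 := by
      rw [mem_candidates, hS.marked ⟨j, hj⟩, hS.undecided ⟨j, hj⟩]
      tauto
    by_cases hc : (⟨j, hj⟩ : Fin I.n) ∈ candidates I.G l F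
    · refine Or.inr ⟨_, hc, ?_, fun y _ h => Nat.lt_succ_iff.1 h⟩
      simp [exec, RamExpr.eval, hsi, h5, h6, hcand.1 hc]
    · have hreg : ((RamProg.exec (.cond (.get 6 (.var 12)) (.cond (.get 5 (.var 12)) .skip
          (.assign 11 (.var 12))) .skip) s').setReg 12 (j + 1)).reg 11 = s'.reg 11 := by
        rw [hcand] at hc
        simp only [exec, RamExpr.eval, hsi, h5, h6]
        split_ifs with h1 h2
        · simp
        · exact absurd ⟨h1, not_not.1 h2⟩ hc
        · simp
      have hne : ∀ y ∈ candidates I.G l F, y.val ≠ j := by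
        rintro y hy rfl
        exact hc hy
      rw [hreg]
      rcases hInv with ⟨h1, h2⟩ | ⟨x, hx, h1, h2⟩
      · exact Or.inl ⟨fun y hy => lt_of_le_of_ne (h1 y hy) (hne y hy).symm, h2⟩
      · exact Or.inr ⟨x, hx, h1, fun y hy h => h2 y hy (lt_of_le_of_ne (Nat.lt_succ_iff.1 h)
          (hne y hy))⟩
  · rintro s' (⟨h1, h2⟩ | ⟨x, hx, h1, h2⟩)
    · refine Or.inl ⟨Finset.eq_empty_of_forall_notMem fun y hy => ?_, h2⟩
      have := h1 y hy
      omega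
    · refine Or.inr ⟨⟨x, hx⟩, h1.trans (congrArg Fin.val ?_)⟩
      exact le_antisymm (Finset.le_max' _ _ hx) (Finset.max'_le _ _ _ fun y hy => h2 y hy y.2)

/-- The number of decision sequences that begin with taking the current vertex. -/
def takeCount : RamExpr :=
  .get 8 (.add (.add (.get 3 (.sub (.var 7) (.lit 1))) (.sub (.var 7) (.lit 1))) (.var 8))

/-- One decision of the exploration: registers `7`, `8`, `9` hold the parameters `a`, `b`, `r` of
`explore`. -/
def exploreStep : RamProg :=
  pickVertex ;;
  .cond (.sub (.var 0) (.var 11))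
    (.cond (.sub takeCount (.var 9))
      (.assign 7 (.sub (.var 7) (.lit 1)) ;; takeVertex)
      (.assign 9 (.sub (.var 9) takeCount) ;; .assign 8 (.sub (.var 8) (.lit 1)) ;;
        .store 5 (.var 11) (.lit 1)))
    (.assign 7 (.lit 0))

/-- The exploration from the vertex in register `5` with the rank in register `6`. -/
def exploreAll : RamProg :=
  forLoop 12 0 (.store 5 (.var 12) (.lit 0) ;; .store 6 (.var 12) (.lit 0)) ;;
  (.assign 10 (.lit 0) ;; .assign 11 (.var 5)) ;; takeVertex ;;
  (.assign 7 (.sub (.var 1) (.lit 1)) ;; .assign 8 (.var 4) ;; .assign 9 (.var 6)) ;;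
  .loop (.var 7) exploreStep

/-- The invariant of the exploration loop: the outcome `res` of the exploration is still to be
reached from the current state, and `m` bounds the number of remaining rounds. -/
def ExploreInv (I : SecludedInstance) (res : List (Fin I.n)) (m : ℕ) (s : RamState) : Prop :=
  Ctx I s ∧ ∃ a b l F, a + b = m ∧ Exploring I l F s ∧ s.reg 7 = a ∧ s.reg 8 = b ∧ a < I.k ∧
    b ≤ min I.t I.n ∧ (a = 0 ∨ s.reg 9 < (a + b).choose a) ∧ explore I.G a b (s.reg 9) l F = res

theorem exploreStep_runs {I : SecludedInstance} (hk : I.k ≤ I.n) {res : List (Fin I.n)} {m : ℕ}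
    {s : RamState} (h : ExploreInv I res m s) (h7 : s.reg 7 ≠ 0) :
    exploreStep.Runs s (60 * (I.n + 1) + 60) (fun s' => ∃ m' < m, ExploreInv I res m' s') := by
  obtain ⟨hC, a, b, l, F, hm, hS, ha, hb, hak, hbt, hr, hres⟩ := h
  rw [ha] at h7
  obtain ⟨a, rfl⟩ := Nat.exists_eq_succ_of_ne_zero h7
  have hr' := hr.resolve_left h7
  refine Runs.seqFrame (pickVertex_runs hC hS) (by omega) fun s₁ hpick hf hg => ?_
  have hC₁ : Ctx I s₁ := hC.congr (fun x hx => hf x (by simp [pickVertex, ModReg]; omega))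
    (fun x _ => hg x (by simp [pickVertex, ModArr])) (hg 8 (by simp [pickVertex, ModArr]))
  have hS₁ : Exploring I l F s₁ := hS.congr (hf 10 (by simp [pickVertex, ModReg]))
    (hg 5 (by simp [pickVertex, ModArr])) (hg 6 (by simp [pickVertex, ModArr]))
    (hg 7 (by simp [pickVertex, ModArr]))
  have ha₁ : s₁.reg 7 = a + 1 := (hf 7 (by simp [pickVertex, ModReg])).trans ha
  have hb₁ : s₁.reg 8 = b := (hf 8 (by simp [pickVertex, ModReg])).trans hb
  have hr₁ : s₁.reg 9 = s.reg 9 := hf 9 (by simp [pickVertex, ModReg])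
  have hcount : takeCount.eval s₁ = (a + b).choose a := by
    simp only [takeCount, RamExpr.eval, ha₁, hb₁, Nat.add_sub_cancel]
    rw [hC₁.mulN a (by omega), ← hC₁.choose a (by omega) b hbt, Nat.mul_succ]
  rw [explore] at hres
  -- Register `11` holds a vertex, below `n`, or else there is no undecided neighbor.
  refine Runs.cond (by simp [RamExpr.cost]; omega) (fun h => ?_) (fun h => ?_)
  · simp only [RamExpr.eval, hC₁.n] at h
    obtain ⟨hne, hx⟩ := hpick.resolve_left (by omega)
    rw [dif_pos hne] at hres
    refine Runs.cond (by simp [RamExpr.cost, takeCount]; omega) (fun h' => ?_) (fun h' => ?_)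
    · simp only [RamExpr.eval, hcount, hr₁] at h'
      rw [if_pos (by omega)] at hres
      refine Runs.seqExec rfl (by simp [maxCost, RamExpr.cost, takeCount]; omega) ?_
      simp only [exec, RamExpr.eval]
      refine (takeVertex_runs (s := s₁.setReg 7 (s₁.reg 7 - 1))
        (hC₁.congr (fun x hx => by interval_cases x <;> simp) (by simp) (by simp))
        (hS₁.congr (by simp) rfl rfl rfl) _ (by simpa using hx)).frame.mono ?_ ?_
      · simp [maxCost, RamExpr.cost, takeCount]; omega
      rintro s₂ ⟨hS₂, hf₂, hg₂⟩
      have h7 := hf₂ 7 (by simp [takeVertex, ModReg])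
      have h8 := hf₂ 8 (by simp [takeVertex, ModReg])
      have h9 := hf₂ 9 (by simp [takeVertex, ModReg])
      simp [ha₁, hb₁, hr₁] at h7 h8 h9
      refine ⟨a + b, by omega, hC₁.congr (fun x hx => ?_) (fun x hx => ?_) ?_, a, b, _, F, rfl,
        hS₂, h7, h8, by omega, hbt, Or.inr (by omega), by rw [h9]; exact hres⟩
      · rw [hf₂ x (by simp [takeVertex, ModReg]; omega)]
        interval_cases x <;> simp
      · rw [hg₂ x (by simp [takeVertex, ModArr]; omega)]; simp
      · rw [hg₂ 8 (by simp [takeVertex, ModArr])]; simp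
    · simp only [RamExpr.eval, hcount, hr₁] at h'
      rw [if_neg (by omega)] at hres
      rw [show a + 1 + b = a + b + 1 by ring, Nat.choose_succ_succ'] at hr'
      cases b with
      -- With `b = 0` the only rank is `0`, which takes the vertex.
      | zero => simp at hr' h'; omega
      | succ b =>
        refine Runs.of_exec rfl (by simp [maxCost, RamExpr.cost, takeCount]; omega) ?_
        refine ⟨a + 1 + b, by omega, ?_⟩
        simp only [exec, RamExpr.eval, hcount, hr₁]
        refine ⟨hC₁.congr (fun x hx => by interval_cases x <;> simp)
          (fun x hx => by interval_cases x <;> simp) (by simp), a + 1, b, l, _, rfl, ?_,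
          by simp [ha₁], by simp [hb₁], hak, by omega, Or.inr ?_, by simpa using hres⟩
        · have hxm := mem_candidates.1 ((candidates I.G l F).max'_mem hne)
          generalize (candidates I.G l F).max' hne = x at *
          constructor
          · simpa using hS₁.length
          · simpa using hS₁.list
          · intro y
            simp only [RamState.setArr_arr, if_true, Function.update_apply,
              RamState.setReg_reg, RamState.setReg_arr, Nat.reduceEqDiff, if_false, hx]
            split_ifs with h
            · obtain rfl := Fin.ext h
              simp [hxm.1]
            · exact hS₁.taken y
          · intro y
            simp only [RamState.setArr_arr, if_true, Function.update_apply,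
              RamState.setReg_reg, RamState.setReg_arr, Nat.reduceEqDiff, if_false, hx,
              Finset.mem_insert, Fin.ext_iff]
            split_ifs with h
            · simp [h]
            · simpa [h] using hS₁.undecided y
          · intro y
            simp only [RamState.setArr_arr, if_true, Function.update_apply,
              RamState.setReg_reg, RamState.setReg_arr, Nat.reduceEqDiff, if_false, hx]
            split_ifs with h
            · norm_num
            · exact hS₁.le_two y
          · simpa using hS₁.marked
        · simp only [RamState.setArr_reg, RamState.setReg_reg, Nat.reduceEqDiff, if_false, if_true]
          rw [show a + 1 + b = a + (b + 1) by ring]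
          omega
  · simp only [RamExpr.eval, hC₁.n] at h
    obtain ⟨hempty, -⟩ := hpick.resolve_right fun ⟨_, hx⟩ => by omega
    rw [dif_neg (by simp [hempty])] at hres
    refine Runs.of_exec rfl (by simp [maxCost, RamExpr.cost]; omega) ?_
    simp only [exec, RamExpr.eval]
    refine ⟨b, by omega, hC₁.congr (fun x hx => by interval_cases x <;> simp) (by simp) (by simp),
      0, b, l, F,
      by simp, hS₁.congr (by simp) rfl rfl rfl, by simp, by simpa using hb₁, by omega, hbt,
      Or.inl rfl, by rw [explore]; exact hres⟩

theorem exploreAll_runs {I : SecludedInstance} (hk : 1 ≤ I.k) (hkn : I.k ≤ I.n) {s : RamState}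
    (hC : Ctx I s) (v : Fin I.n) (hv : s.reg 5 = v)
    (hr : s.reg 6 < (I.k - 1 + min I.t I.n).choose (I.k - 1)) :
    exploreAll.Runs s (300 * (I.n + 1) ^ 2)
      (fun s' => ∃ F, Exploring I (I.found v (s.reg 6)) F s') := by
  have hsq : (I.n + 1) ^ 2 = I.n * (I.n + 1) + I.n + 1 := by ring
  have hsq' : I.n + 1 ≤ (I.n + 1) ^ 2 := Nat.le_self_pow two_ne_zero _
  have hn : 1 ≤ I.n := hk.trans hkn
  refine Runs.seqFrame (Runs.forLoop (B := 6) (N := I.n) (T := 30 * (I.n + 1)) (Inv := fun j s' =>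
    ∀ y < j, s'.arr 5 y = 0 ∧ s'.arr 6 y = 0) (by omega) (by simp) (by simp [ModReg])
    (by simp [ModReg]) hC.n (by simp) ?_) (by omega) ?_
  · intro j s' hj hInv hsi _ _ _
    refine Runs.of_exec rfl (by simp [maxCost, RamExpr.cost]) fun y hy => ?_
    simp only [exec, RamExpr.eval, RamState.setReg_arr, RamState.setArr_arr, RamState.setArr_reg,
      if_true, hsi, Nat.reduceEqDiff, if_false, Function.update_apply]
    split_ifs with h
    · exact ⟨rfl, rfl⟩
    · exact hInv y (by omega)
  intro s₁ hz hf₁ hg₁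
  refine Runs.seqExec rfl (by simp [maxCost, RamExpr.cost]; omega) ?_
  simp only [exec, RamExpr.eval]
  have hC₁ : Ctx I s₁ := hC.congr (fun x hx => hf₁ x (by simp [ModReg]; omega))
    (fun x hx => hg₁ x (by simp [ModArr]; omega)) (hg₁ 8 (by simp [ModArr]))
  refine Runs.seqFrame (takeVertex_runs (I := I) (l := []) (F := ∅)
    (hC₁.congr (fun x hx => by interval_cases x <;> simp) (by simp) (by simp)) ?_ v ?_) ?_ ?_
  · constructor <;> simp [hz]
  · simp [hf₁ 5 (by simp [ModReg]), hv]
  · simp [maxCost, RamExpr.cost]; omega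
  intro s₂ hS₂ hf₂ hg₂
  have hC₂ : Ctx I s₂ := hC₁.congr
    (fun x hx => by
      rw [hf₂ x (by simp [takeVertex, ModReg]; omega)]
      interval_cases x <;> simp)
    (fun x hx => by rw [hg₂ x (by simp [takeVertex, ModArr]; omega)]; simp)
    (by rw [hg₂ 8 (by simp [takeVertex, ModArr])]; simp)
  have h6 : s₂.reg 6 = s.reg 6 := by
    rw [hf₂ 6 (by simp [takeVertex, ModReg])]
    simpa using hf₁ 6 (by simp [ModReg])
  refine Runs.seqExec rfl (by simp [maxCost, RamExpr.cost]; omega) ?_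
  simp only [exec, RamExpr.eval]
  refine (Runs.loop (B := 60 * (I.n + 1) + 60) (Inv := ExploreInv I (I.found v (s.reg 6)))
    (fun j s' h h7 => exploreStep_runs hkn h (by exact h7)) (I.k - 1 + min I.t I.n) _ ?_).mono ?_ ?_
  · refine ⟨hC₂.congr (fun x hx => by interval_cases x <;> simp) (by simp) (by simp),
      I.k - 1, min I.t I.n,
      [v], ∅, rfl, hS₂.congr (by simp) rfl rfl rfl, by simp [hC₂.k], by simp [hC₂.t'], by omega,
      le_rfl, Or.inr (by simpa [h6] using hr), ?_⟩
    simp [h6, SecludedInstance.found]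
  · simp only [maxCost, RamExpr.cost]
    have h1 : I.k - 1 + min I.t I.n ≤ 2 * I.n - 1 := by omega
    have h2 := Nat.mul_le_mul_right (1 + 1 + (60 * (I.n + 1) + 60)) h1
    have h3 : (2 * I.n - 1) * (1 + 1 + (60 * (I.n + 1) + 60)) + (1 + 1 + (60 * (I.n + 1) + 60)) =
      2 * I.n * (1 + 1 + (60 * (I.n + 1) + 60)) := by
      rw [← Nat.succ_mul]; congr 1; omega
    have h4 : 2 * I.n * (1 + 1 + (60 * (I.n + 1) + 60)) = 120 * (I.n * (I.n + 1)) + 124 * I.n := by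
      ring
    have h5 : I.n ≤ I.n * (I.n + 1) := Nat.le_mul_of_pos_right _ (by omega)
    omega
  · rintro s' ⟨h7, m, -, a, b, l, F, -, hS, ha, -, -, -, -, hres⟩
    simp only [RamExpr.eval] at h7
    obtain rfl : a = 0 := ha.symm.trans h7
    rw [explore] at hres
    exact ⟨F, hres ▸ hS⟩

end SecludedProgram

/-! ### Calling another program and undoing its changes -/

/-- The expression with registers and arrays renamed to `32, 33, …` and `16, 17, …`. -/
def RamExpr.shift : RamExpr → RamExpr
  | lit c => lit c
  | var x => var (x + 32)
  | add e₁ e₂ => add e₁.shift e₂.shift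
  | sub e₁ e₂ => sub e₁.shift e₂.shift
  | get a e => get (a + 16) e.shift

/-- The memory of the called program: the registers from `32` on and the arrays from `16` on. -/
def RamState.inner (s : RamState) : RamState :=
  ⟨fun x => s.reg (x + 32), fun a => s.arr (a + 16)⟩

theorem RamExpr.eval_shift (s : RamState) (e : RamExpr) : e.shift.eval s = e.eval s.inner := by
  induction e <;> simp_all [shift, eval, RamState.inner]

theorem RamExpr.cost_shift (e : RamExpr) : e.shift.cost = e.cost := by
  induction e <;> simp_all [shift, cost]

namespace SecludedProgram

open RamProg

/-- The program `p` on the memory `RamState.inner`, where the index of every array cell that is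
written is also appended to the log, array `9` with its length in register `17`. -/
def logged : RamProg → RamProg
  | .skip => .skip
  | .assign x e => .assign (x + 32) e.shift
  | .store a i e =>
    .store 9 (.var 17) i.shift ;; .assign 17 (.add (.var 17) (.lit 1)) ;;
      .store (a + 16) i.shift e.shift
  | .seq p q => logged p ;; logged q
  | .cond e p q => .cond e.shift (logged p) (logged q)
  | .loop e p => .loop e.shift (logged p)

theorem modReg_logged {p : RamProg} {x : ℕ} (h : (logged p).ModReg x) :
    x = 17 ∨ ∃ y, p.ModReg y ∧ x = y + 32 := by
  induction p with
  | skip => simp [logged, ModReg] at h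
  | assign y e => exact Or.inr ⟨y, rfl, h⟩
  | store a i e => simpa [logged, ModReg] using h
  | seq p q ihp ihq => simp only [logged, ModReg] at *; grind
  | cond e p q ihp ihq => simp only [logged, ModReg] at *; grind
  | loop e p ih => simp only [logged, ModReg] at *; grind

theorem modArr_logged {p : RamProg} {a : ℕ} (h : (logged p).ModArr a) :
    a = 9 ∨ ∃ b, p.ModArr b ∧ a = b + 16 := by
  induction p with
  | skip => simp [logged, ModArr] at h
  | assign y e => simp [logged, ModArr] at h
  | store a i e => simpa [logged, ModArr] using h
  | seq p q ihp ihq => simp only [logged, ModArr] at *; grind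
  | cond e p q ihp ihq => simp only [logged, ModArr] at *; grind
  | loop e p ih => simp only [logged, ModArr] at *; grind

/-- `s'` extends the log of `s` by at most `m` entries, which include the index of every cell of
the called program that differs. -/
structure LogExtends (s s' : RamState) (m : ℕ) : Prop where
  le : s.reg 17 ≤ s'.reg 17
  le_add : s'.reg 17 ≤ s.reg 17 + m
  old : ∀ i < s.reg 17, s'.arr 9 i = s.arr 9 i
  new : ∀ a i, s'.arr (a + 16) i ≠ s.arr (a + 16) i →
    ∃ c, s.reg 17 ≤ c ∧ c < s'.reg 17 ∧ s'.arr 9 c = i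

theorem LogExtends.refl (s : RamState) (m : ℕ) : LogExtends s s m :=
  ⟨le_rfl, by omega, fun _ _ => rfl, fun _ _ h => absurd rfl h⟩

theorem LogExtends.trans {s s' s'' : RamState} {m m' m₁ : ℕ} (h : LogExtends s s' m)
    (h' : LogExtends s' s'' m') (hm : m + m' ≤ m₁) : LogExtends s s'' m₁ := by
  refine ⟨h.le.trans h'.le, by have := h.le_add; have := h'.le_add; omega,
    fun i hi => (h'.old i (hi.trans_le h.le)).trans (h.old i hi), fun a i hai => ?_⟩
  by_cases hd : s''.arr (a + 16) i = s'.arr (a + 16) i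
  · obtain ⟨c, h1, h2, h3⟩ := h.new a i (hd ▸ hai)
    exact ⟨c, h1, h2.trans_le h'.le, (h'.old c h2).trans h3⟩
  · obtain ⟨c, h1, h2, h3⟩ := h'.new a i hd
    exact ⟨c, h.le.trans h1, h2, h3⟩

/-- The logged program simulates the original one, with a constant factor of overhead. -/
theorem exists_logged_exec {p : RamProg} {s₀ s₁ : RamState} {m : ℕ} (h : RamExec p s₀ s₁ m) :
    ∀ s : RamState, s.inner = s₀ → ∃ s' m', RamExec (logged p) s s' m' ∧ m' ≤ 5 * m ∧
      s'.inner = s₁ ∧ LogExtends s s' m := by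
  induction h with
  | skip s₀ => exact fun s hs => ⟨s, 1, .skip s, by omega, hs, .refl _ _⟩
  | assign s₀ x e =>
    rintro s rfl
    refine ⟨_, _, .assign _ _ _, by simp only [RamExpr.cost_shift]; omega, ?_, ⟨?_, ?_, ?_, ?_⟩⟩
    · simp only [RamState.inner, RamExpr.eval_shift]
      congr 1
      funext y
      simp [Function.update_apply]
    all_goals simp
  | store s₀ a i e =>
    rintro s rfl
    have hi := i.one_le_cost
    have he := e.one_le_cost
    obtain ⟨s', m', h1, h2, rfl⟩ := exec_runs (p := logged (.store a i e)) rfl s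
    have hin : (RamProg.exec (.assign 17 (.add (.var 17) (.lit 1)))
        (RamProg.exec (.store 9 (.var 17) i.shift) s)).inner = s.inner := by
      simp [RamState.inner, exec]
    refine ⟨_, m', h1, h2.trans ?_, ?_, ?_⟩
    · simp [logged, maxCost, RamExpr.cost_shift, RamExpr.cost]
      omega
    · simp only [logged, exec, RamExpr.eval_shift] at hin ⊢
      rw [hin]
      simp only [RamState.inner]
      congr 1
      · funext b
        simp [Function.update_apply]
    · simp only [logged, exec, RamExpr.eval_shift] at hin ⊢
      rw [hin]
      refine ⟨?_, ?_, fun c hc => ?_, fun b c hbc => ⟨s.reg 17, le_rfl, ?_, ?_⟩⟩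
      · simp [RamExpr.eval]
      · simp [RamExpr.eval]
      · simp [RamExpr.eval, hc.ne]
      · simp [RamExpr.eval]
      · simp only [RamState.setArr_arr, RamState.setReg_arr, Nat.add_right_cancel_iff] at hbc ⊢
        have h9 : ∀ x, x + 16 ≠ 9 := fun x => by omega
        simp only [(h9 _).symm, h9, if_false, if_true, Function.update_apply] at hbc ⊢
        by_contra hne
        refine hbc ?_
        split_ifs with h3
        · rw [Function.update_of_ne (by simpa [eq_comm, RamExpr.eval] using hne), h3]
        · rfl
  | seq _ _ ih₁ ih₂ =>
    intro s hs
    obtain ⟨s', m₁, h1, h2, h3, h4⟩ := ih₁ s hs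
    obtain ⟨s'', m₂, h5, h6, h7, h8⟩ := ih₂ s' h3
    exact ⟨s'', _, h1.seq h5, by omega, h7, h4.trans h8 le_rfl⟩
  | cond_true he _ ih =>
    rintro s rfl
    obtain ⟨s', m₁, h1, h2, h3, h4⟩ := ih s rfl
    exact ⟨s', _, .cond_true (by rwa [RamExpr.eval_shift]) h1,
      by rw [RamExpr.cost_shift]; omega, h3, h4.trans (.refl _ 0) (by omega)⟩
  | cond_false he _ ih =>
    rintro s rfl
    obtain ⟨s', m₁, h1, h2, h3, h4⟩ := ih s rfl
    exact ⟨s', _, .cond_false (by rwa [RamExpr.eval_shift]) h1,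
      by rw [RamExpr.cost_shift]; omega, h3, h4.trans (.refl _ 0) (by omega)⟩
  | loop_false he =>
    rintro s rfl
    exact ⟨s, _, .loop_false (by rwa [RamExpr.eval_shift]), by rw [RamExpr.cost_shift]; omega, rfl,
      .refl _ _⟩
  | loop_true he _ _ ih₁ ih₂ =>
    rintro s rfl
    obtain ⟨s', m₁, h1, h2, h3, h4⟩ := ih₁ s rfl
    obtain ⟨s'', m₂, h5, h6, h7, h8⟩ := ih₂ s' h3
    exact ⟨s'', _, .loop_true (by rwa [RamExpr.eval_shift]) h1 h5,
      by rw [RamExpr.cost_shift]; omega, h7, h4.trans h8 (by omega)⟩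

/-- A program assigns only to finitely many registers and arrays. -/
theorem exists_mod_lt (p : RamProg) :
    ∃ M, 0 < M ∧ (∀ x, p.ModReg x → x < M) ∧ ∀ a, p.ModArr a → a < M := by
  induction p with
  | skip => exact ⟨1, by simp [ModReg, ModArr]⟩
  | assign x e => exact ⟨x + 1, by simp [ModReg, ModArr]⟩
  | store a i e => exact ⟨a + 1, by simp [ModReg, ModArr]⟩
  | seq p q ihp ihq =>
    obtain ⟨M, h1, h2, h3⟩ := ihp
    obtain ⟨N, h4, h5, h6⟩ := ihq
    exact ⟨M + N, by omega, by simp only [ModReg]; grind, by simp only [ModArr]; grind⟩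
  | cond e p q ihp ihq =>
    obtain ⟨M, h1, h2, h3⟩ := ihp
    obtain ⟨N, h4, h5, h6⟩ := ihq
    exact ⟨M + N, by omega, by simp only [ModReg]; grind, by simp only [ModArr]; grind⟩
  | loop e p ih => exact ih

/-- Set the first `m` registers of the called program to zero. -/
def zeroRegs : ℕ → RamProg
  | 0 => .skip
  | m + 1 => zeroRegs m ;; .assign (m + 32) (.lit 0)

/-- Set the cell with the index `log[length]` in the first `m` arrays of the called program to
zero. -/
def zeroCells : ℕ → RamProg
  | 0 => .skip
  | m + 1 => zeroCells m ;; .store (m + 16) (.get 9 (.var 17)) (.lit 0)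

theorem zeroRegs_spec (m : ℕ) (s : RamState) : (zeroRegs m).LoopFree = true ∧
    (zeroRegs m).maxCost = 2 * m + 1 ∧ ((zeroRegs m).exec s).arr = s.arr ∧
    ∀ x, ((zeroRegs m).exec s).reg x = if 32 ≤ x ∧ x < m + 32 then 0 else s.reg x := by
  induction m with
  | zero =>
    refine ⟨rfl, rfl, rfl, fun x => ?_⟩
    rw [if_neg (by omega)]
    rfl
  | succ m ih =>
    obtain ⟨h1, h2, h3, h4⟩ := ih
    refine ⟨by simp [zeroRegs, LoopFree, h1], by simp [zeroRegs, maxCost, h2, RamExpr.cost]; ring,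
      by simp [zeroRegs, exec, h3], fun x => ?_⟩
    simp only [zeroRegs, exec, RamState.setReg_reg, h4, RamExpr.eval]
    grind

theorem zeroCells_spec (m : ℕ) (s : RamState) : (zeroCells m).LoopFree = true ∧
    (zeroCells m).maxCost = 4 * m + 1 ∧ ((zeroCells m).exec s).reg = s.reg ∧
    ((zeroCells m).exec s).arr 9 = s.arr 9 ∧
    ∀ a i, ((zeroCells m).exec s).arr (a + 16) i =
      if a < m ∧ i = s.arr 9 (s.reg 17) then 0 else s.arr (a + 16) i := by
  induction m with
  | zero =>
    refine ⟨rfl, rfl, rfl, rfl, fun a i => ?_⟩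
    rw [if_neg (by omega)]
    rfl
  | succ m ih =>
    obtain ⟨h1, h2, h3, h4, h5⟩ := ih
    refine ⟨by simp [zeroCells, LoopFree, h1], by simp [zeroCells, maxCost, h2, RamExpr.cost]; ring,
      by simp [zeroCells, exec, h3], by simp [zeroCells, exec, h4], fun a i => ?_⟩
    simp only [zeroCells, exec, RamState.setArr_arr, RamExpr.eval, h3, h4, Nat.add_right_cancel_iff]
    split_ifs with h6 h7 h7
    · subst h6; simp [h7.2]
    · subst h6
      have : i ≠ s.arr 9 (s.reg 17) := fun h => h7 ⟨by omega, h⟩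
      rw [Function.update_of_ne this, h5, if_neg (by tauto)]
    · rw [h5, if_pos ⟨by omega, h7.2⟩]
    · rw [h5, if_neg (fun h => h7 ⟨by omega, h.2⟩)]

theorem modReg_zeroRegs {m x : ℕ} (h : (zeroRegs m).ModReg x) : 32 ≤ x := by
  induction m with
  | zero => exact h.elim
  | succ m ih => exact h.elim ih (by rintro rfl; omega)

theorem modArr_zeroRegs {m a : ℕ} : ¬ (zeroRegs m).ModArr a := by
  induction m <;> simp_all [zeroRegs, ModArr]

theorem modReg_zeroCells {m x : ℕ} : ¬ (zeroCells m).ModReg x := by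
  induction m <;> simp_all [zeroCells, ModReg]

theorem modArr_zeroCells {m a : ℕ} (h : (zeroCells m).ModArr a) : 16 ≤ a := by
  induction m with
  | zero => exact h.elim
  | succ m ih => exact h.elim ih (by rintro rfl; omega)

/-- Zero the cells in the log. -/
def undo (M : ℕ) : RamProg :=
  .loop (.var 17) (.assign 17 (.sub (.var 17) (.lit 1)) ;; zeroCells M)

/-- Call the program `p`, set register `15` to one if it accepts, and clean up its memory. -/
def call (p : RamProg) (M : ℕ) : RamProg :=
  logged p ;; .cond (.var 32) (.assign 15 (.lit 1)) .skip ;; zeroRegs M ;; undo M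

/-- After `undo`, a cell in the first `M` arrays of the called program either is zero or was not in
the log and has kept its content. -/
theorem undo_runs (M : ℕ) (s : RamState) :
    (undo M).Runs s (s.reg 17 * (4 * M + 7) + 2) (fun s' => s'.reg 17 = 0 ∧
      ∀ a i, (s'.arr (a + 16) i = s.arr (a + 16) i ∧
        ∀ c < s.reg 17, s.arr 9 c = i → M ≤ a) ∨ s'.arr (a + 16) i = 0) := by
  refine (Runs.loop (B := 4 * M + 5) (Inv := fun j s' => s'.reg 17 = j ∧ j ≤ s.reg 17 ∧
    s'.arr 9 = s.arr 9 ∧ ∀ a i, (s'.arr (a + 16) i = s.arr (a + 16) i ∧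
      ∀ c < s.reg 17, j ≤ c → s.arr 9 c = i → M ≤ a) ∨ s'.arr (a + 16) i = 0)
    ?_ (s.reg 17) s ?_).mono ?_ ?_
  · rintro j s' ⟨h1, h2, h3, h4⟩ hj
    simp only [RamExpr.eval, h1] at hj
    obtain ⟨z1, z2, z3, z4, z5⟩ := zeroCells_spec M (s'.setReg 17 (j - 1))
    refine Runs.of_exec (by simp [LoopFree, z1]) (by simp [maxCost, z2, RamExpr.cost]; omega)
      ⟨j - 1, by omega, ?_⟩
    simp only [exec, RamExpr.eval, h1, z3, z4, z5]
    refine ⟨by simp, by omega, h3, fun a i => ?_⟩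
    simp only [RamState.setReg_arr, RamState.setReg_reg, if_true, h3]
    split_ifs with h5
    · exact Or.inr rfl
    · refine (h4 a i).imp_left fun ⟨h6, h7⟩ => ⟨h6, fun c hc hjc hci => ?_⟩
      rcases Nat.lt_or_ge c j with hcj | hcj
      · have : c = j - 1 := by omega
        subst this
        by_contra! hM
        exact h5 ⟨hM, hci.symm⟩
      · exact h7 c hc hcj hci
  · exact ⟨rfl, le_rfl, rfl, fun a i => Or.inl ⟨rfl, fun c hc hc' => by omega⟩⟩
  · simp only [RamExpr.cost]
    rw [show 1 + 1 + (4 * M + 5) = 4 * M + 7 by ring]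
  · rintro s' ⟨he, j, h1, -, -, h4⟩
    have hj : j = 0 := h1.symm.trans he
    subst hj
    exact ⟨h1, fun a i => (h4 a i).imp_left fun ⟨h5, h6⟩ =>
      ⟨h5, fun c hc => h6 c hc (by omega)⟩⟩

/-- A call costs a constant factor over the run of `p`, and afterwards the registers of the called
program are zero and its array cells are zero or as before the call. -/
theorem call_runs {p : RamProg} {M : ℕ} (hMr : ∀ x, p.ModReg x → x < M)
    (hMa : ∀ a, p.ModArr a → a < M) (hM : 0 < M) {s s₁ : RamState} {m : ℕ}
    (h : RamExec p s.inner s₁ m) (h17 : s.reg 17 = 0) (hz : ∀ x, 32 < x → s.reg x = 0) :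
    (call p M).Runs s ((4 * M + 12) * m + (2 * M + 10)) (fun s' =>
      (s'.reg 15 ≠ 0 ↔ s₁.reg 0 ≠ 0 ∨ s.reg 15 ≠ 0) ∧ s'.reg 17 = 0 ∧
      (∀ x, 32 ≤ x → s'.reg x = 0) ∧
      ∀ a i, s'.arr (a + 16) i = s.arr (a + 16) i ∨ s'.arr (a + 16) i = 0) := by
  obtain ⟨s₂, m₂, e₂, t₂, i₂, l₂⟩ := exists_logged_exec h s rfl
  have hexp : (4 * M + 12) * m = 5 * m + m * (4 * M + 7) := by ring
  refine Runs.seqFrame (Q₁ := (· = s₂)) ⟨s₂, m₂, e₂, t₂, rfl⟩ (by omega) ?_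
  intro s' hs' hf hg
  rw [hs'] at hf hg ⊢
  refine Runs.seqExec rfl (by simp [maxCost, RamExpr.cost]; omega) ?_
  set s₃ := RamProg.exec (.cond (.var 32) (.assign 15 (.lit 1)) .skip) s₂ with hs₃
  obtain ⟨z1, z2, z3, z4⟩ := zeroRegs_spec M s₃
  refine Runs.seqExec z1 (by simp [z2, maxCost, RamExpr.cost]; omega) ?_
  have h15 : s₂.reg 15 = s.reg 15 := hf 15 fun hc => by
    rcases modReg_logged hc with h | ⟨y, -, h⟩ <;> omega
  have h32 : s₂.reg 32 = s₁.reg 0 := congrArg (fun t => t.reg 0) i₂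
  have hreg : ∀ x ≠ 15, s₃.reg x = s₂.reg x := fun x hx => by
    simp only [hs₃, exec, RamExpr.eval]
    by_cases h : s₂.reg 32 = 0 <;> simp [h, hx]
  have harr : s₃.arr = s₂.arr := by
    simp only [hs₃, exec, RamExpr.eval]
    by_cases h : s₂.reg 32 = 0 <;> simp [h]
  refine (undo_runs M _).frame.mono ?_ ?_
  · have h1 : ((zeroRegs M).exec s₃).reg 17 ≤ m := by
      rw [z4, if_neg (by omega), hreg 17 (by norm_num)]
      have := l₂.le_add
      omega
    have h2 := Nat.mul_le_mul_right (4 * M + 7) h1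
    simp only [maxCost, RamExpr.cost, z2]
    omega
  · rintro s' ⟨⟨u1, u2⟩, u3, u4⟩
    have hmod : ∀ x, x ≠ 17 → s'.reg x = ((zeroRegs M).exec s₃).reg x := fun x hx =>
      u3 x (by simp [undo, ModReg, modReg_zeroCells, hx])
    refine ⟨?_, u1, fun x hx => ?_, fun a i => ?_⟩
    · rw [hmod 15 (by norm_num), z4, if_neg (by omega)]
      simp only [hs₃, exec, RamExpr.eval, h32]
      split_ifs with h
      · simp [h]
      · simp only [not_not] at h
        simp [h, h15]
    · rw [hmod x (by omega), z4]
      split_ifs with hxM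
      · rfl
      · rw [hreg x (by omega), hf x ?_, hz x (by omega)]
        intro hc
        rcases modReg_logged hc with h | ⟨y, hy, h⟩
        · omega
        · have := hMr y hy
          omega
    · refine (u2 a i).imp_left fun ⟨v1, v2⟩ => ?_
      rw [z3, harr] at v1 v2
      rw [v1]
      by_contra hne
      obtain ⟨c, -, c2, c3⟩ := l₂.new a i hne
      -- A changed cell is in the log, so it survives `undo` only if its array is not among the first
      -- `M`; but the program does not write to such an array.
      have hMa' : M ≤ a := v2 c (by rwa [z4, if_neg (by omega), hreg 17 (by norm_num)]) c3
      refine hne (congrFun (hg (a + 16) fun hc => ?_) i)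
      rcases modArr_logged hc with h | ⟨b, hb, h⟩
      · omega
      · have := hMa b hb
        omega

end SecludedProgram

/-! ### Checking a candidate -/

namespace SecludedProgram

open RamProg

theorem modReg_call {p : RamProg} {M x : ℕ} (h : (call p M).ModReg x) :
    x = 15 ∨ x = 17 ∨ 32 ≤ x := by
  rcases h with h | (h | h) | h | h | h
  · rcases modReg_logged h with h | ⟨y, -, h⟩ <;> omega
  · exact Or.inl h
  · exact h.elim
  · exact Or.inr (Or.inr (modReg_zeroRegs h))
  · exact Or.inr (Or.inl h)
  · exact (modReg_zeroCells h).elim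

theorem modArr_call {p : RamProg} {M a : ℕ} (h : (call p M).ModArr a) : a = 9 ∨ 16 ≤ a := by
  rcases h with h | (h | h) | h | h | h
  · rcases modArr_logged h with h | ⟨y, -, h⟩ <;> omega
  · exact h.elim
  · exact h.elim
  · exact (modArr_zeroRegs h).elim
  · exact h.elim
  · exact Or.inr (modArr_zeroCells h)

/-- The memory of the called program is zero, except possibly for the cells that are overwritten
when the next graph on `k` vertices is written there. -/
structure Clean (k : ℕ) (s : RamState) : Prop where
  log : s.reg 17 = 0
  reg : ∀ x, 32 ≤ x → s.reg x = 0
  arr : ∀ a i, (a = 0 → k * k ≤ i) → (a = 1 → k ≤ i) → s.arr (a + 16) i = 0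

theorem Clean.congr {k : ℕ} {s s' : RamState} (h : Clean k s) (h17 : s'.reg 17 = s.reg 17)
    (hr : ∀ x, 32 ≤ x → s'.reg x = s.reg x) (ha : ∀ a, 16 ≤ a → s'.arr a = s.arr a) :
    Clean k s' :=
  ⟨h17.trans h.log, fun x hx => (hr x hx).trans (h.reg x hx), fun a i h0 h1 => by
    rw [ha _ (by omega)]; exact h.arr a i h0 h1⟩

/-- Write the colored graph that is induced by the list in array `7` into the memory of the called
program. -/
def writeGraph : RamProg :=
  .assign 32 (.var 1) ;;
  forLoop 12 1 (forLoop 13 1 (.store 16 (.add (.get 4 (.var 12)) (.var 13))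
    (.get 0 (.add (.get 3 (.get 7 (.var 12))) (.get 7 (.var 13)))))) ;;
  forLoop 12 1 (.store 17 (.var 12) (.get 1 (.get 7 (.var 12))))

theorem writeGraph_runs {I : SecludedInstance} {l : List (Fin I.n)} {F : Finset (Fin I.n)}
    {s : RamState} (hC : Ctx I s) (hS : Exploring I l F s) (hl : l.length = I.k)
    (hZ : Clean I.k s) :
    writeGraph.Runs s (60 * (I.k + 1) ^ 2)
      (fun s' => s'.inner = (listColoredGraph I.G I.color l).encode) := by
  set X := listColoredGraph I.G I.color l with hX
  have hXn : X.n = I.k := hl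
  have hsq : (I.k + 1) ^ 2 = I.k * (I.k + 1) + I.k + 1 := by ring
  have hadj : ∀ u v, u < I.k → v < I.k → s.arr 0 (s.arr 3 (s.arr 7 u) + s.arr 7 v) =
      adjacencyArray X.G (u * I.k + v) := by
    intro u v hu hv
    have h1 := adjacencyArray_apply X.G ⟨u, hXn ▸ hu⟩ ⟨v, hXn ▸ hv⟩
    simp only [hXn] at h1
    rw [h1, hS.list u (by omega), hS.list v (by omega), hC.mulN _ (Fin.is_lt _), hC.adj,
      adjacencyArray_apply]
    rfl
  have hcol : ∀ u < I.k, s.arr 1 (s.arr 7 u) = vertexArray X.color u := by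
    intro u hu
    rw [hS.list u (by omega), hC.color, vertexArray_apply,
      vertexArray_apply X.color ⟨u, hXn ▸ hu⟩]
    rfl
  refine Runs.seqExec rfl (by simp [maxCost, RamExpr.cost]; omega) ?_
  simp only [exec, RamExpr.eval, hC.k]
  refine Runs.seqFrame (Runs.forLoop (B := 20 * (I.k + 1)) (N := I.k)
    (T := I.k * (20 * (I.k + 1) + 8) + 6) (Inv := fun j s' =>
    ∀ i, (i < j * I.k ∨ I.k * I.k ≤ i) → s'.arr 16 i = adjacencyArray X.G i)
    le_rfl (by simp) (by simp [ModReg]) (by simp [ModReg]) (by simp [hC.k]) ?_ ?_) ?_ ?_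
  · intro i hi
    rw [adjacencyArray_of_le X.G (by rw [hXn]; omega)]
    exact hZ.arr 0 i (by omega) (by omega)
  · intro j s' hj hInv hsi hsb hf hg
    refine Runs.forLoop (B := 12) (N := I.k) (Inv := fun v s' =>
      ∀ i, (i < j * I.k + v ∨ I.k * I.k ≤ i) → s'.arr 16 i = adjacencyArray X.G i)
      (by omega) (by simp) (by simp [ModReg]) (by simp [ModReg]) hsb (by simpa using hInv) ?_
      |>.mono le_rfl ?_
    · intro v s'' hv hInv' hsi' _ hf' hg'
      refine Runs.of_exec rfl (by simp [maxCost, RamExpr.cost]) fun i hi => ?_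
      have h12 : s''.reg 12 = j := (hf' 12 (by simp) (by simp [ModReg])).trans hsi
      have harr : ∀ a, a ≠ 16 → s''.arr a = s.arr a := fun a ha =>
        (hg' a (by simpa [ModArr] using ha)).trans (hg a (by simpa [ModArr] using ha))
      simp only [exec, RamExpr.eval, RamState.setReg_arr, RamState.setArr_arr, if_true, h12, hsi',
        harr _ (by norm_num : 0 ≠ 16), harr _ (by norm_num : 3 ≠ 16), harr _ (by norm_num : 4 ≠ 16),
        harr _ (by norm_num : 7 ≠ 16), hadj j v hj hv, hC.mulK j hj, Function.update_apply]
      split_ifs with h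
      · rw [h]
      · exact hInv' i (by omega)
    · intro s'' h i hi
      refine h i (hi.imp_left fun h => ?_)
      rwa [Nat.add_mul, Nat.one_mul] at h
  · simp only [maxCost, RamExpr.cost]
    have : I.k * (20 * (I.k + 1) + 8) = 20 * (I.k * (I.k + 1)) + 8 * I.k := by ring
    omega
  intro s₁ hInv hf hg
  refine (Runs.forLoop (B := 8) (N := I.k) (Inv := fun j s' =>
    ∀ i, (i < j ∨ I.k ≤ i) → s'.arr 17 i = vertexArray X.color i) ?_ (by simp) (by simp [ModReg])
    (by simp [ModReg]) ?_ ?_ ?_).frame.mono le_rfl ?_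
  · simp only [maxCost, RamExpr.cost]
    have : I.k * (20 * (I.k + 1) + 8) = 20 * (I.k * (I.k + 1)) + 8 * I.k := by ring
    omega
  · rw [hf 1 (by simp [ModReg])]
    simp [hC.k]
  · intro i hi
    rw [vertexArray_of_le X.color (by rw [hXn]; omega)]
    simp only [RamState.setReg_arr]
    rw [hg 17 (by simp [ModArr])]
    exact hZ.arr 1 i (by omega) (by omega)
  · intro j s' hj hInv' hsi _ hf' hg'
    refine Runs.of_exec rfl (by simp [maxCost, RamExpr.cost]) fun i hi => ?_
    have harr : ∀ a, a ≠ 16 → a ≠ 17 → s'.arr a = s.arr a := fun a ha ha' =>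
      (hg' a (by simpa [ModArr] using ha')).trans (hg a (by simpa [ModArr] using ha))
    simp only [exec, RamExpr.eval, RamState.setReg_arr, RamState.setArr_arr, if_true, hsi,
      harr 1 (by norm_num) (by norm_num), harr 7 (by norm_num) (by norm_num), hcol j hj,
      Function.update_apply]
    split_ifs with h
    · rw [h]
    · exact hInv' i (by omega)
  · rintro s₂ ⟨hInv₂, hf₂, hg₂⟩
    simp only [RamState.inner, ColoredGraph.encode, RamState.mk.injEq]
    constructor
    · funext x
      rw [hf₂ _ (by simp [ModReg]), hf _ (by simp [ModReg])]
      by_cases hx : x = 0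
      · simp [hx, hXn]
      · simpa [hx] using hZ.reg (x + 32) (by omega)
    · funext a
      by_cases h0 : a = 0
      · subst h0
        funext i
        rw [if_pos rfl, hg₂ _ (by simp [ModArr])]
        exact hInv i (by omega)
      · rw [if_neg h0]
        by_cases h1 : a = 1
        · subst h1
          funext i
          rw [if_pos rfl]
          exact hInv₂ i (by omega)
        · rw [if_neg h1, hg₂ _ (by simp [ModArr]; omega), hg _ (by simp [ModArr]; omega)]
          funext i
          exact hZ.arr a i (by omega) (by omega)

/-- Set register `14` to the size of the neighborhood and register `18` to the weight. -/
def measure : RamProg :=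
  .assign 14 (.lit 0) ;;
  forLoop 12 0 (.cond (.get 6 (.var 12)) (.cond (.sub (.lit 2) (.get 5 (.var 12)))
    (.assign 14 (.add (.var 14) (.lit 1))) .skip) .skip) ;;
  .assign 18 (.lit 0) ;;
  forLoop 12 1 (.assign 18 (.add (.var 18) (.get 2 (.get 7 (.var 12)))))

theorem measure_runs {I : SecludedInstance} {l : List (Fin I.n)} {F : Finset (Fin I.n)}
    {s : RamState} (hC : Ctx I s) (hS : Exploring I l F s) (hl : l.length = I.k) (hk : I.k ≤ I.n) :
    measure.Runs s (60 * (I.n + 1)) (fun s' =>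
      s'.reg 14 = {y | y ∉ l ∧ ∃ u ∈ l, I.G.Adj u y}.ncard ∧
      s'.reg 18 = (l.map I.weight).sum) := by
  have hcount : {y | y ∉ l ∧ ∃ u ∈ l, I.G.Adj u y}.ncard =
      ((Finset.range I.n).filter fun y => s.arr 6 y ≠ 0 ∧ s.arr 5 y ≠ 2).card := by
    rw [← Set.ncard_image_of_injective _ Fin.val_injective, ← Set.ncard_coe_finset]
    congr 1
    ext y
    simp only [Set.mem_image, Set.mem_ofPred_eq, Finset.coe_filter, Finset.mem_range]
    constructor
    · rintro ⟨y, ⟨h1, h2⟩, rfl⟩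
      exact ⟨y.2, (hS.marked y).2 h2, fun h => h1 ((hS.taken y).1 h)⟩
    · rintro ⟨h1, h2, h3⟩
      exact ⟨⟨y, h1⟩, ⟨fun h => h3 ((hS.taken _).2 h), (hS.marked ⟨y, h1⟩).1 h2⟩, rfl⟩
  refine Runs.seqExec rfl (by simp [maxCost, RamExpr.cost]; omega) ?_
  simp only [exec, RamExpr.eval]
  refine Runs.seqFrame (Runs.forLoop (B := 16) (N := I.n) (T := 30 * (I.n + 1))
    (Inv := fun j s' => s'.reg 14 =
      ((Finset.range j).filter fun y => s.arr 6 y ≠ 0 ∧ s.arr 5 y ≠ 2).card)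
    (by omega) (by simp) (by simp [ModReg]) (by simp [ModReg]) (by simp [hC.n]) (by simp) ?_)
    (by simp [maxCost, RamExpr.cost]; omega) ?_
  · intro j s' hj hInv hsi _ hf hg
    refine Runs.of_exec rfl (by simp [maxCost, RamExpr.cost]) ?_
    have h5 := hg 5 (by simp [ModArr])
    have h6 := hg 6 (by simp [ModArr])
    simp only [RamState.setReg_arr] at h5 h6
    have hle := hS.le_two ⟨j, hj⟩
    simp only at hle
    simp only [exec, RamExpr.eval, hsi, h5, h6, Finset.range_add_one, Finset.filter_insert]
    by_cases h1 : s.arr 6 j = 0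
    · simp [h1, hInv]
    · by_cases h2 : s.arr 5 j = 2
      · simp [h1, h2, hInv]
      · have h3 : 2 - s.arr 5 j ≠ 0 := by omega
        simp [h1, h2, h3, hInv]
  intro s₁ hcnt hf hg
  rw [← hcount] at hcnt
  refine Runs.seqExec rfl (by simp [maxCost, RamExpr.cost]; omega) ?_
  simp only [exec, RamExpr.eval]
  refine (Runs.forLoop (B := 8) (N := I.k) (Inv := fun j s' => s'.reg 18 =
    ((l.take j).map I.weight).sum) (by simp [maxCost, RamExpr.cost]; omega) (by simp)
    (by simp [ModReg]) (by simp [ModReg]) ?_ (by simp) ?_).frame.mono le_rfl ?_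
  · have := hf 1 (by simp [ModReg])
    simp at this
    simp [this, hC.k]
  · intro j s' hj hInv hsi _ hf' hg'
    refine Runs.of_exec rfl (by simp [maxCost, RamExpr.cost]) ?_
    have h2 := (hg' 2 (by simp [ModArr])).trans (hg 2 (by simp [ModArr]))
    have h7 := (hg' 7 (by simp [ModArr])).trans (hg 7 (by simp [ModArr]))
    simp only [RamState.setReg_arr] at h2 h7
    have hjl : j < l.length := by omega
    simp [exec, RamExpr.eval, hsi, h2, h7, hInv, hS.list j hjl, hC.weight, vertexArray_apply]
    rw [List.sum_take_succ _ j (by simpa using hjl), List.getElem_map]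
  · rintro s₂ ⟨hInv, hf₂, -⟩
    refine ⟨?_, by rw [hInv, ← hl, List.take_length]⟩
    rw [hf₂ 14 (by simp [ModReg])]
    simpa using hcnt

/-- Test the outcome of an exploration, the property by calling the program `p`, and set register
`15` to one if all tests are passed. -/
def check (p : RamProg) (M : ℕ) : RamProg :=
  .cond (.add (.sub (.var 1) (.var 10)) (.sub (.var 10) (.var 1))) .skip
    (measure ;; .cond (.sub (.var 14) (.var 2)) .skip
      (.cond (.sub (.var 3) (.var 18)) .skip (writeGraph ;; call p M)))

theorem modReg_check {p : RamProg} {M x : ℕ} (h : (check p M).ModReg x) :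
    12 ≤ x ∧ x ≠ 16 ∧ x ≠ 19 := by
  have hm : measure.ModReg x → 12 ≤ x ∧ x ≠ 16 ∧ x ≠ 19 := by simp [measure, ModReg]; omega
  have hw : writeGraph.ModReg x → 12 ≤ x ∧ x ≠ 16 ∧ x ≠ 19 := by simp [writeGraph, ModReg]; omega
  have hc := modReg_call (p := p) (M := M) (x := x)
  simp only [check, ModReg] at h
  grind

theorem modArr_check {p : RamProg} {M a : ℕ} (h : (check p M).ModArr a) : 9 ≤ a := by
  have hm : ¬ measure.ModArr a := by simp [measure, ModArr]
  have hw : writeGraph.ModArr a → 9 ≤ a := by simp [writeGraph, ModArr]; omega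
  have hc := modArr_call (p := p) (M := M) (a := a)
  simp only [check, ModArr] at h
  grind

/-- The program `p` recognizes the property `P` on graphs with `k` vertices within time `T`, and
it assigns only to registers and arrays below `M`. -/
structure Recognizer (P : ColoredGraphProperty) (p : RamProg) (M k T : ℕ) : Prop where
  pos : 0 < M
  reg : ∀ x, p.ModReg x → x < M
  arr : ∀ a, p.ModArr a → a < M
  runs : ∀ X : ColoredGraph, X.n = k →
    p.Runs X.encode T (fun s => s.reg 0 ≠ 0 ↔ P.holds X.G X.color)

theorem check_runs {P : ColoredGraphProperty} {p : RamProg} {M T : ℕ} {I : SecludedInstance}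
    (hp : Recognizer P p M I.k T) (hk : I.k ≤ I.n) {l : List (Fin I.n)} {F : Finset (Fin I.n)}
    {s : RamState} (hC : Ctx I s) (hS : Exploring I l F s) (hZ : Clean I.k s) :
    (check p M).Runs s (150 * (I.n + 1) ^ 2 + ((4 * M + 12) * T + (2 * M + 10)))
      (fun s' => (s'.reg 15 ≠ 0 ↔ I.Good P l ∨ s.reg 15 ≠ 0) ∧ Clean I.k s') := by
  have hsq : I.n + 1 ≤ (I.n + 1) ^ 2 := Nat.le_self_pow two_ne_zero _
  have hksq : (I.k + 1) ^ 2 ≤ (I.n + 1) ^ 2 := Nat.pow_le_pow_left (by omega) 2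
  refine Runs.cond (by simp [RamExpr.cost]; omega) (fun h => ?_) (fun h => ?_)
  · simp only [RamExpr.eval, hC.k, hS.length] at h
    refine Runs.of_exec rfl (by simp [maxCost, RamExpr.cost]; omega) ⟨?_, hZ⟩
    have : ¬ I.Good P l := fun hG => h (by have := hG.1; omega)
    simp [exec, this]
  simp only [RamExpr.eval, hC.k, hS.length] at h
  have hl : l.length = I.k := by omega
  refine Runs.seqFrame (measure_runs hC hS hl hk) (by simp [RamExpr.cost]; omega) ?_
  rintro s₁ ⟨h14, h18⟩ hf hg
  have hr₁ : ∀ x, x < 12 ∨ x = 15 ∨ x = 17 ∨ 32 ≤ x → s₁.reg x = s.reg x :=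
    fun x hx => hf x (by simp [measure, ModReg]; omega)
  have ha₁ : ∀ a, s₁.arr a = s.arr a := fun a => hg a (by simp [measure, ModArr])
  have hC₁ : Ctx I s₁ := hC.congr (fun x hx => hr₁ x (by omega)) (fun a _ => ha₁ a) (ha₁ 8)
  have hS₁ : Exploring I l F s₁ := hS.congr (hr₁ 10 (by omega)) (ha₁ 5) (ha₁ 6) (ha₁ 7)
  have hZ₁ : Clean I.k s₁ := hZ.congr (hr₁ 17 (by omega)) (fun x hx => hr₁ x (by omega))
    (fun a _ => ha₁ a)
  have h15 : s₁.reg 15 = s.reg 15 := hr₁ 15 (by omega)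
  refine Runs.cond (by simp [RamExpr.cost]; omega) (fun h => ?_) (fun h => ?_)
  · simp only [RamExpr.eval, hC₁.t, h14] at h
    refine Runs.of_exec rfl (by simp [maxCost, RamExpr.cost]; omega) ⟨?_, hZ₁⟩
    have : ¬ I.Good P l := fun hG => h (by have := hG.2.1; omega)
    simp [exec, this, h15]
  simp only [RamExpr.eval, hC₁.t, h14] at h
  refine Runs.cond (by simp [RamExpr.cost]; omega) (fun h' => ?_) (fun h' => ?_)
  · simp only [RamExpr.eval, hC₁.w, h18] at h'
    refine Runs.of_exec rfl (by simp [maxCost, RamExpr.cost]; omega) ⟨?_, hZ₁⟩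
    have : ¬ I.Good P l := fun hG => h' (by have := hG.2.2.1; omega)
    simp [exec, this, h15]
  simp only [RamExpr.eval, hC₁.w, h18] at h'
  refine Runs.seqFrame (writeGraph_runs hC₁ hS₁ hl hZ₁) (by simp [RamExpr.cost]; omega) ?_
  intro s₂ hin hf₂ hg₂
  have hG : I.Good P l ↔
      P.holds (listColoredGraph I.G I.color l).G (listColoredGraph I.G I.color l).color := by
    rw [SecludedInstance.Good, and_iff_right hl, and_iff_right (by omega), and_iff_right (by omega)]
  obtain ⟨s₃, m, e, hm, hacc⟩ := hp.runs (listColoredGraph I.G I.color l) hl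
  rw [← hin] at e
  have hm' := Nat.mul_le_mul_left (4 * M + 12) hm
  refine (call_runs hp.reg hp.arr hp.pos e ?_ ?_).mono ?_ ?_
  · rw [hf₂ 17 (by simp [writeGraph, ModReg]), hZ₁.log]
  · intro x hx
    rw [hf₂ x (by simp [writeGraph, ModReg]; omega), hZ₁.reg x (by omega)]
  · simp [RamExpr.cost]; omega
  · rintro s' ⟨c1, c2, c3, c4⟩
    refine ⟨?_, c2, c3, fun a i h0 h1 => ?_⟩
    · rw [c1, hacc, hG, hf₂ 15 (by simp [writeGraph, ModReg]), h15]
    · refine (c4 a i).elim (fun h => h.trans ?_) id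
      have h2 := congrFun (congrFun (congrArg RamState.arr hin) a) i
      simp only [RamState.inner, ColoredGraph.encode] at h2
      have hn : (listColoredGraph I.G I.color l).n = I.k := hl
      rw [h2]
      split_ifs with ha ha'
      · exact adjacencyArray_of_le _ (by rw [hn]; exact h0 ha)
      · exact vertexArray_of_le _ (by rw [hn]; exact h1 ha')
      · rfl

end SecludedProgram

/-! ### The whole program -/

namespace SecludedProgram

open RamProg

/-- Explore from all vertices and with all ranks, and check the outcomes. -/
def search (p : RamProg) (M : ℕ) : RamProg :=
  forLoop 5 0 (forLoop 6 16 (exploreAll ;; check p M))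

theorem modReg_exploreAll {x : ℕ} (h : exploreAll.ModReg x) : 7 ≤ x ∧ x ≤ 12 := by
  simp [exploreAll, exploreStep, pickVertex, takeVertex, ModReg] at h
  omega

theorem modArr_exploreAll {a : ℕ} (h : exploreAll.ModArr a) : 5 ≤ a ∧ a ≤ 7 := by
  simp [exploreAll, exploreStep, pickVertex, takeVertex, ModArr] at h
  omega

theorem modReg_explore_check {p : RamProg} {M x : ℕ} (h : (exploreAll ;; check p M).ModReg x) :
    7 ≤ x ∧ x ≠ 16 ∧ x ≠ 19 := by
  rcases h with h | h
  · have := modReg_exploreAll h; omega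
  · have := modReg_check h; omega

theorem modArr_explore_check {p : RamProg} {M a : ℕ} (h : (exploreAll ;; check p M).ModArr a) :
    5 ≤ a ∧ a ≠ 8 := by
  rcases h with h | h
  · have := modArr_exploreAll h; omega
  · have := modArr_check h; omega

theorem explore_check_runs {P : ColoredGraphProperty} {p : RamProg} {M T : ℕ}
    {I : SecludedInstance} (hp : Recognizer P p M I.k T) (hk : 1 ≤ I.k) (hkn : I.k ≤ I.n)
    {s : RamState} (hC : Ctx I s) (hZ : Clean I.k s) (v : Fin I.n) (hv : s.reg 5 = v)
    (hr : s.reg 6 < (I.k - 1 + min I.t I.n).choose (I.k - 1)) :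
    (exploreAll ;; check p M).Runs s
      (450 * (I.n + 1) ^ 2 + ((4 * M + 12) * T + (2 * M + 10)))
      (fun s' => (s'.reg 15 ≠ 0 ↔ I.Good P (I.found v (s.reg 6)) ∨ s.reg 15 ≠ 0) ∧
        Clean I.k s') := by
  refine Runs.seqFrame (exploreAll_runs hk hkn hC v hv hr) (by omega) ?_
  rintro s₁ ⟨F, hS⟩ hf hg
  have hf' : ∀ x, x < 7 ∨ 12 < x → s₁.reg x = s.reg x := fun x hx => hf x fun h => by
    have := modReg_exploreAll h; omega
  have hg' : ∀ a, a < 5 ∨ 7 < a → s₁.arr a = s.arr a := fun a ha => hg a fun h => by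
    have := modArr_exploreAll h; omega
  refine (check_runs hp hkn (hC.congr (fun x hx => hf' x (by omega)) (fun a ha => hg' a (by omega))
    (hg' 8 (by omega))) hS (hZ.congr (hf' 17 (by omega)) (fun x hx => hf' x (by omega))
    (fun a ha => hg' a (by omega)))).mono (by omega) ?_
  rintro s' ⟨h1, h2⟩
  exact ⟨by rw [h1, hf' 15 (by omega)], h2⟩

/-- The register `15` tells whether some exploration so far had a good outcome; that all of them
have been tried is what `SecludedInstance.isYes_iff` requires. -/
theorem search_runs {P : ColoredGraphProperty} {p : RamProg} {M T : ℕ} {I : SecludedInstance}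
    (hp : Recognizer P p M I.k T) (hk : 1 ≤ I.k) (hkn : I.k ≤ I.n) {s : RamState} (hC : Ctx I s)
    (hZ : Clean I.k s) {R : ℕ} (hR : R = (I.k - 1 + min I.t I.n).choose (I.k - 1))
    (h16 : s.reg 16 = R) (h15 : s.reg 15 = 0) :
    (search p M).Runs s
      (I.n * (R * (450 * (I.n + 1) ^ 2 + ((4 * M + 12) * T + (2 * M + 10)) + 8) + 6 + 8) + 6)
      (fun s' => s'.reg 15 ≠ 0 ↔ I.IsYes P) := by
  have hmodR : ∀ x, ¬ (7 ≤ x ∧ x ≠ 16 ∧ x ≠ 19) → ¬ (exploreAll ;; check p M).ModReg x :=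
    fun x hx h => hx (modReg_explore_check h)
  have hmodA : ∀ a, ¬ (5 ≤ a ∧ a ≠ 8) → ¬ (exploreAll ;; check p M).ModArr a :=
    fun a ha h => ha (modArr_explore_check h)
  refine (Runs.forLoop (N := I.n) (Inv := fun j s' => Clean I.k s' ∧ (s'.reg 15 ≠ 0 ↔
    ∃ v : Fin I.n, v.val < j ∧ ∃ r < R, I.Good P (I.found v r))) le_rfl (by simp) ?_ ?_ hC.n ?_
    ?_).mono le_rfl ?_
  · rw [modReg_forLoop]; simpa using hmodR 5 (by omega)
  · rw [modReg_forLoop]; simpa using hmodR 0 (by omega)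
  · exact ⟨hZ.congr (by simp) (fun x hx => by simp; omega) (by simp), by simp [h15]⟩
  · rintro j s₁ hj ⟨hZ₁, h15₁⟩ hj₁ - hf hg
    have hf₁ : ∀ x, x < 5 ∨ x = 16 → s₁.reg x = s.reg x := fun x hx => hf x (by omega) (by
      rw [modReg_forLoop]
      rintro (h | h)
      · omega
      · exact hmodR x (by omega) h)
    have hg₁ : ∀ a, a < 5 ∨ a = 8 → s₁.arr a = s.arr a := fun a ha => hg a (by
      rw [modArr_forLoop]; exact hmodA a (by omega))
    refine (Runs.forLoop (N := R) (Inv := fun r s' => Clean I.k s' ∧ (s'.reg 15 ≠ 0 ↔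
      s₁.reg 15 ≠ 0 ∨ ∃ r' < r, I.Good P (I.found ⟨j, hj⟩ r'))) le_rfl (by simp)
      (hmodR 6 (by omega)) (hmodR 16 (by omega)) ((hf₁ 16 (by omega)).trans h16) ?_ ?_).mono
      le_rfl ?_
    · exact ⟨hZ₁.congr (by simp) (fun x hx => by simp; omega) (by simp), by simp⟩
    · rintro r s₂ hr ⟨hZ₂, h15₂⟩ hr₂ - hf' hg'
      have hf₂ : ∀ x, x < 5 → s₂.reg x = s.reg x := fun x hx =>
        (hf' x (by omega) (hmodR x (by omega))).trans (hf₁ x (by omega))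
      have hg₂ : ∀ a, a < 5 ∨ a = 8 → s₂.arr a = s.arr a := fun a ha =>
        (hg' a (hmodA a (by omega))).trans (hg₁ a ha)
      refine (explore_check_runs hp hk hkn (hC.congr (fun x hx => hf₂ x (by omega))
        (fun a ha => hg₂ a (by omega)) (hg₂ 8 (by omega))) hZ₂ ⟨j, hj⟩
        ((hf' 5 (by omega) (hmodR 5 (by omega))).trans hj₁) (by omega)).mono le_rfl ?_
      rintro s₃ ⟨h15₃, hZ₃⟩
      refine ⟨hZ₃.congr (by simp) (fun x hx => by simp; omega) (by simp), ?_⟩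
      simp only [RamState.setReg_reg, Nat.reduceEqDiff, if_false]
      rw [h15₃, h15₂, hr₂]
      constructor
      · rintro (h | h | ⟨r', h1, h2⟩)
        · exact Or.inr ⟨r, by omega, h⟩
        · exact Or.inl h
        · exact Or.inr ⟨r', by omega, h2⟩
      · rintro (h | ⟨r', h1, h2⟩)
        · exact Or.inr (Or.inl h)
        · rcases Nat.lt_succ_iff_lt_or_eq.1 h1 with h1 | rfl
          · exact Or.inr (Or.inr ⟨r', h1, h2⟩)
          · exact Or.inl h2
    · rintro s₂ ⟨hZ₂, h15₂⟩
      refine ⟨hZ₂.congr (by simp) (fun x hx => by simp; omega) (by simp), ?_⟩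
      simp only [RamState.setReg_reg, Nat.reduceEqDiff, if_false]
      rw [h15₂, h15₁]
      constructor
      · rintro (⟨v, h1, h2⟩ | h)
        · exact ⟨v, by omega, h2⟩
        · exact ⟨⟨j, hj⟩, by simp, h⟩
      · rintro ⟨v, h1, h2⟩
        rcases Nat.lt_succ_iff_lt_or_eq.1 h1 with h1 | rfl
        · exact Or.inl ⟨v, h1, h2⟩
        · exact Or.inr h2
  · rintro s' ⟨-, h⟩
    rw [h, SecludedInstance.isYes_iff P I hk, ← hR]
    simp

/-- Fill array `a` with the first multiples of the content of register `b`, in that number. -/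
def multiples (a b : ℕ) : RamProg :=
  .assign 14 (.lit 0) ;;
  forLoop 12 b (.store a (.var 12) (.var 14) ;; .assign 14 (.add (.var 14) (.var b)))

theorem multiples_runs {a b m : ℕ} (hb : b < 12) {s : RamState} (hm : s.reg b = m) :
    (multiples a b).Runs s (20 * (m + 1)) (fun s' => ∀ i < m, s'.arr a i = i * m) := by
  refine Runs.seqExec rfl (by simp [maxCost, RamExpr.cost]; omega) ?_
  refine (Runs.forLoop (B := 8) (N := m) (Inv := fun j s' => s'.reg 14 = j * m ∧
    ∀ i < j, s'.arr a i = i * m) (by simp [maxCost, RamExpr.cost]; omega) (by omega)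
    (by simp [ModReg]) (by simp [ModReg]; omega) ?_ (by simp [exec, RamExpr.eval]) ?_).mono le_rfl
    fun s' h => h.2
  · simp [exec, hm]; omega
  · rintro j s' hj ⟨h14, hInv⟩ hsi hsb - -
    refine Runs.of_exec rfl (by simp [maxCost, RamExpr.cost]) ⟨?_, fun i hi => ?_⟩
    · simp [exec, RamExpr.eval, h14, hsb, Nat.add_mul]
    · simp only [exec, RamExpr.eval, RamState.setReg_arr, RamState.setArr_arr, if_true, hsi, h14,
        Function.update_apply]
      split_ifs with h
      · rw [h]
      · exact hInv i (by omega)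

/-- The entry `(i, j)` of the table in array `8`. -/
def entry (i j : RamExpr) : RamExpr := .add (.add (.get 3 i) i) j

/-- Fill array `8` with the binomial coefficients `(i + j).choose i`, by Pascal's rule. -/
def pascal : RamProg :=
  forLoop 12 1 (forLoop 13 19
    (.cond (.var 12)
      (.cond (.var 13)
        (.store 8 (entry (.var 12) (.var 13))
          (.add (.get 8 (entry (.sub (.var 12) (.lit 1)) (.var 13)))
            (.get 8 (entry (.var 12) (.sub (.var 13) (.lit 1))))))
        (.store 8 (entry (.var 12) (.var 13)) (.lit 1)))
      (.store 8 (entry (.var 12) (.var 13)) (.lit 1))))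

theorem pascal_runs {n k t : ℕ} (hk : k ≤ n) (ht : t ≤ n) {s : RamState} (h1 : s.reg 1 = k)
    (h19 : s.reg 19 = t + 1) (h3 : ∀ i < n, s.arr 3 i = i * n) :
    pascal.Runs s (100 * (n + 1) ^ 2) (fun s' => ∀ i < k, ∀ j ≤ t,
      s'.arr 8 (i * (n + 1) + j) = (i + j).choose i) := by
  refine (Runs.forLoop (B := (t + 1) * 70 + 6) (N := k) (Inv := fun i' s' => ∀ i < i', ∀ j ≤ t,
    s'.arr 8 (i * (n + 1) + j) = (i + j).choose i) ?_ (by simp) (by simp [ModReg])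
    (by simp [ModReg]) h1 (by simp) ?_)
  · have e1 : k * ((t + 1) * 70 + 6 + 8) ≤ n * ((n + 1) * 70 + 6 + 8) :=
      Nat.mul_le_mul hk (by omega)
    nlinarith
  intro i' s₁ hi' hInv hi₁ _ hf hg
  refine (Runs.forLoop (B := 62) (N := t + 1) (Inv := fun j' s' => ∀ i j, i ≤ i' → j ≤ t →
    (i < i' ∨ j < j') → s'.arr 8 (i * (n + 1) + j) = (i + j).choose i) (by omega) (by simp)
    (by simp [ModReg]) (by simp [ModReg]) ?_ ?_ ?_).mono le_rfl ?_
  · rw [hf 19 (by simp) (by simp [ModReg]), h19]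
  · intro i j _ hj h
    exact hInv i (by omega) j hj
  · intro j' s₂ hj' hInv' hj₂ _ hf' hg'
    have h12 : s₂.reg 12 = i' := (hf' 12 (by simp) (by simp [ModReg])).trans hi₁
    have h3' : ∀ i < n, s₂.arr 3 i = i * n := fun i hi => by
      rw [hg' 3 (by simp [ModArr]), hg 3 (by simp [ModArr]), h3 i hi]
    have hidx : ∀ a, a < n → ∀ j, s₂.arr 3 a + a + j = a * (n + 1) + j := fun a ha j => by
      rw [h3' a ha, Nat.mul_succ]
    have hval : (RamProg.exec (.cond (.var 12)
        (.cond (.var 13)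
          (.store 8 (entry (.var 12) (.var 13))
            (.add (.get 8 (entry (.sub (.var 12) (.lit 1)) (.var 13)))
              (.get 8 (entry (.var 12) (.sub (.var 13) (.lit 1))))))
          (.store 8 (entry (.var 12) (.var 13)) (.lit 1)))
        (.store 8 (entry (.var 12) (.var 13)) (.lit 1))) s₂) =
        s₂.setArr 8 (i' * (n + 1) + j') ((i' + j').choose i') := by
      simp only [exec, entry, RamExpr.eval, h12, hj₂]
      rw [hidx i' (by omega), hidx (i' - 1) (by omega), hidx i' (by omega)]
      split_ifs with g1 g2
      · obtain ⟨a, rfl⟩ := Nat.exists_eq_succ_of_ne_zero g1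
        obtain ⟨b, rfl⟩ := Nat.exists_eq_succ_of_ne_zero g2
        simp only [Nat.succ_eq_add_one, Nat.add_sub_cancel]
        rw [hInv' a (b + 1) (by omega) (by omega) (by omega),
          hInv' (a + 1) b (by omega) (by omega) (by omega),
          show a + 1 + (b + 1) = a + (b + 1) + 1 by ring, Nat.choose_succ_succ',
          show a + 1 + b = a + (b + 1) by ring]
      · rw [not_not.1 g2]; simp
      · rw [not_not.1 g1]; simp
    refine Runs.of_exec rfl (by simp [maxCost, RamExpr.cost, entry]) ?_
    rw [hval]
    intro i j hi hj h
    simp only [RamState.setReg_arr, RamState.setArr_arr, if_true, Function.update_apply]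
    split_ifs with g
    · rw [mul_add_inj_of_lt (by omega) (by omega)] at g
      rw [g.1, g.2]
    · rw [mul_add_inj_of_lt (by omega) (by omega)] at g
      exact hInv' i j hi hj (by omega)
  · intro s₂ h i hi j hj
    exact h i j (by omega) hj (by omega)

/-- Build the tables, and put the number of ranks that have to be tried into register `16`. -/
def prepare : RamProg :=
  (.assign 4 (.sub (.var 0) (.sub (.var 0) (.var 2))) ;; .assign 19 (.add (.var 4) (.lit 1))) ;;
  multiples 3 0 ;; multiples 4 1 ;; pascal ;;
  .assign 16 (.get 8 (entry (.sub (.var 1) (.lit 1)) (.var 4)))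

theorem prepare_runs {I : SecludedInstance} (hk : 1 ≤ I.k) (hkn : I.k ≤ I.n) {s : RamState}
    (hs : s = I.encode.setReg 15 0) :
    prepare.Runs s (200 * (I.n + 1) ^ 2) (fun s' => Ctx I s' ∧ Clean I.k s' ∧
      s'.reg 16 = (I.k - 1 + min I.t I.n).choose (I.k - 1) ∧ s'.reg 15 = 0) := by
  have hsq : I.n + 1 ≤ (I.n + 1) ^ 2 := Nat.le_self_pow two_ne_zero _
  refine Runs.seqExec rfl (by simp [maxCost, RamExpr.cost]; omega) ?_
  -- The machine computes the minimum by two truncated subtractions.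
  have ht : I.n - (I.n - I.t) = min I.t I.n := by omega
  have hr0 : ∀ x, (RamProg.exec (.assign 4 (.sub (.var 0) (.sub (.var 0) (.var 2))) ;;
      .assign 19 (.add (.var 4) (.lit 1))) s).reg x = if x = 19 then min I.t I.n + 1 else
        if x = 4 then min I.t I.n else I.encode.reg x := by
    intro x
    subst hs
    by_cases hx : x = 15
    · subst hx; simp [exec, SecludedInstance.encode]
    · simp [exec, RamExpr.eval, SecludedInstance.encode, ht, hx]
  have ha0 : (RamProg.exec (.assign 4 (.sub (.var 0) (.sub (.var 0) (.var 2))) ;;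
      .assign 19 (.add (.var 4) (.lit 1))) s).arr = I.encode.arr := by
    simp [exec, hs]
  generalize RamProg.exec (.assign 4 (.sub (.var 0) (.sub (.var 0) (.var 2))) ;;
      .assign 19 (.add (.var 4) (.lit 1))) s = s₀ at hr0 ha0 ⊢
  refine Runs.seqFrame (multiples_runs (m := I.n) (by norm_num) (by
    simp [hr0, SecludedInstance.encode])) (by simp [maxCost, RamExpr.cost]; omega) ?_
  intro s₁ hm₁ hf₁ hg₁
  refine Runs.seqFrame (multiples_runs (m := I.k) (by norm_num) (by
    rw [hf₁ 1 (by simp [multiples, ModReg])]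
    simp [hr0, SecludedInstance.encode])) (by simp [maxCost, RamExpr.cost]; omega) ?_
  intro s₂ hm₂ hf₂ hg₂
  have hmul : ∀ x, x ≠ 12 → x ≠ 14 → s₂.reg x = s₀.reg x := fun x h12 h14 => by
    rw [hf₂ x (by simp [multiples, ModReg, h12, h14]),
      hf₁ x (by simp [multiples, ModReg, h12, h14])]
  refine Runs.seqFrame (pascal_runs (t := min I.t I.n) hkn (by omega) ?_ ?_ ?_)
    (by simp [maxCost, RamExpr.cost]; omega) ?_
  · rw [hmul 1 (by norm_num) (by norm_num)]
    simp [hr0, SecludedInstance.encode]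
  · rw [hmul 19 (by norm_num) (by norm_num)]
    simp [hr0]
  · intro i hi
    rw [hg₂ 3 (by simp [multiples, ModArr]), hm₁ i hi]
  intro s₃ hm₃ hf₃ hg₃
  refine Runs.of_exec rfl (by simp [maxCost, RamExpr.cost, entry]; omega) ?_
  have hr₃ : ∀ x, x ≠ 12 → x ≠ 13 → x ≠ 14 → s₃.reg x = if x = 19 then min I.t I.n + 1 else
      if x = 4 then min I.t I.n else I.encode.reg x := fun x h12 h13 h14 => by
    rw [hf₃ x (by simp [pascal, ModReg, h12, h13]), hmul x h12 h14, hr0]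
  have ha₃ : ∀ a, a ≠ 3 → a ≠ 4 → a ≠ 8 → s₃.arr a = I.encode.arr a := fun a h3 h4 h8 => by
    rw [hg₃ a (by simp [pascal, ModArr, h8]), hg₂ a (by simp [multiples, ModArr, h4]),
      hg₁ a (by simp [multiples, ModArr, h3]), ha0]
  have hC : Ctx I s₃ := by
    constructor
    · simp [hr₃, SecludedInstance.encode]
    · simp [hr₃, SecludedInstance.encode]
    · simp [hr₃, SecludedInstance.encode]
    · simp [hr₃, SecludedInstance.encode]
    · simp [hr₃]
    · simp [ha₃, SecludedInstance.encode]
    · simp [ha₃, SecludedInstance.encode]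
    · simp [ha₃, SecludedInstance.encode]
    · intro u hu
      rw [hg₃ 3 (by simp [pascal, ModArr]), hg₂ 3 (by simp [multiples, ModArr]), hm₁ u hu]
    · intro u hu
      rw [hg₃ 4 (by simp [pascal, ModArr]), hm₂ u hu]
    · exact hm₃
  simp only [exec]
  refine ⟨hC.congr (fun x hx => by simp; omega) (by simp) (by simp), ⟨?_, ?_, ?_⟩, ?_, ?_⟩
  · simp [hr₃, SecludedInstance.encode]
  · intro x hx
    rw [RamState.setReg_reg, if_neg (by omega), hr₃ x (by omega) (by omega) (by omega),
      if_neg (by omega), if_neg (by omega)]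
    simp only [SecludedInstance.encode]
    rw [if_neg (by omega), if_neg (by omega), if_neg (by omega), if_neg (by omega)]
  · intro a i _ _
    rw [RamState.setReg_arr, ha₃ _ (by omega) (by omega) (by omega)]
    simp [SecludedInstance.encode]
  · simp only [RamState.setReg_reg, if_true, entry, RamExpr.eval, hC.k, hC.t']
    rw [hC.mulN _ (by omega), ← hC.choose _ (by omega) _ le_rfl, Nat.mul_succ]
  · simp [hr₃, SecludedInstance.encode]

/-- Decide the problem by calling `p` for the property. -/
def solve (p : RamProg) (M : ℕ) : RamProg :=
  .assign 15 (.lit 0) ;;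
  .cond (.var 1) (.cond (.sub (.var 1) (.var 0)) .skip (prepare ;; search p M)) .skip ;;
  .assign 0 (.var 15)

theorem card_le_of_isYes {P : ColoredGraphProperty} {I : SecludedInstance} (h : I.IsYes P) :
    1 ≤ I.k ∧ I.k ≤ I.n := by
  obtain ⟨U, hc, -, -, hU, -⟩ := h
  obtain ⟨v, hv⟩ := hc.nonempty
  rw [← hU]
  exact ⟨Finset.card_pos.2 ⟨v, hv⟩, (Finset.card_le_univ U).trans (by simp)⟩

theorem solve_runs {P : ColoredGraphProperty} {p : RamProg} {M T : ℕ} {I : SecludedInstance}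
    (hp : Recognizer P p M I.k T) (hT : 1 ≤ T) :
    (solve p M).Runs I.encode
      ((1000 + 10 * M) * ((I.k - 1 + min I.t I.n).choose (I.k - 1) * T * (I.n + 1) ^ 3))
      (fun s => s.reg 0 ≠ 0 ↔ I.IsYes P) := by
  set R := (I.k - 1 + min I.t I.n).choose (I.k - 1) with hR
  have hR1 : 1 ≤ R := Nat.choose_pos (by omega)
  set Y := R * T * (I.n + 1) ^ 3 with hY
  have hY1 : 1 ≤ Y := Nat.mul_pos (Nat.mul_pos hR1 hT) (by positivity)
  have hT' : (solve p M).Runs I.encode ((1 + 1) + ((5 + 200 * (I.n + 1) ^ 2 +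
      (I.n * (R * (450 * (I.n + 1) ^ 2 + ((4 * M + 12) * T + (2 * M + 10)) + 8) + 6 + 8) + 6) + 4) +
      2)) (fun s => s.reg 0 ≠ 0 ↔ I.IsYes P) := by
    refine Runs.seqExec rfl (by simp [maxCost, RamExpr.cost]) ?_
    refine Runs.seq (T₁ := 5 + 200 * (I.n + 1) ^ 2 +
      (I.n * (R * (450 * (I.n + 1) ^ 2 + ((4 * M + 12) * T + (2 * M + 10)) + 8) + 6 + 8) + 6) + 4)
      (Q₁ := fun s => s.reg 15 ≠ 0 ↔ I.IsYes P) ?_ (by simp [maxCost, RamExpr.cost]) ?_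
    · refine Runs.cond (by simp [RamExpr.cost]) (fun h => ?_) (fun h => ?_)
      · simp only [exec, RamExpr.eval, RamState.setReg_reg, Nat.reduceEqDiff, if_false,
          SecludedInstance.encode, if_true] at h
        refine Runs.cond (by simp [RamExpr.cost]; omega) (fun h' => ?_) (fun h' => ?_)
        · simp only [exec, RamExpr.eval, RamState.setReg_reg, Nat.reduceEqDiff, if_false,
            SecludedInstance.encode, if_true] at h'
          refine Runs.of_exec rfl (by simp [maxCost, RamExpr.cost]; omega) ?_
          have : ¬ I.IsYes P := fun hyes => h' (by have := (card_le_of_isYes hyes).2; omega)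
          simp [exec, RamExpr.eval, this]
        · simp only [exec, RamExpr.eval, RamState.setReg_reg, Nat.reduceEqDiff, if_false,
            SecludedInstance.encode, if_true] at h'
          have hk : 1 ≤ I.k := by omega
          have hkn : I.k ≤ I.n := by omega
          refine Runs.seq (prepare_runs hk hkn rfl) (by simp [RamExpr.cost]; omega) ?_
          rintro s₁ ⟨hC, hZ, h16, h15⟩
          exact (search_runs hp hk hkn hC hZ rfl h16 h15).mono (by
            simp only [RamExpr.cost, ← hR]; omega) fun _ h => h
      · simp only [exec, RamExpr.eval, RamState.setReg_reg, Nat.reduceEqDiff, if_false,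
          SecludedInstance.encode, if_true] at h
        refine Runs.of_exec rfl (by simp [maxCost, RamExpr.cost]) ?_
        have : ¬ I.IsYes P := fun hyes => by
          have := (card_le_of_isYes hyes).1
          omega
        simp [exec, RamExpr.eval, this]
    · intro s' h
      refine Runs.of_exec rfl (by simp [maxCost, RamExpr.cost]) ?_
      simpa [exec, RamExpr.eval] using h
  refine hT'.mono ?_ fun _ h => h
  -- Every term of the time bound is at most a constant multiple of `Y`.
  have hN : 1 ≤ (I.n + 1) ^ 2 := Nat.one_le_pow _ _ (by omega)
  have hnN : I.n * (I.n + 1) ^ 2 ≤ (I.n + 1) ^ 3 := by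
    rw [pow_succ' _ 2]; exact Nat.mul_le_mul_right _ (by omega)
  have hN3 : (I.n + 1) ^ 2 ≤ (I.n + 1) ^ 3 := Nat.pow_le_pow_right (by omega) (by omega)
  have hn3 : I.n ≤ (I.n + 1) ^ 3 := (Nat.le_mul_of_pos_right _ hN).trans hnN
  have y1 : (I.n + 1) ^ 2 ≤ Y :=
    hN3.trans (Nat.le_mul_of_pos_left _ (Nat.mul_pos hR1 hT))
  have y2 : R * (I.n * (I.n + 1) ^ 2) ≤ Y := by
    rw [hY]; exact Nat.mul_le_mul (Nat.le_mul_of_pos_right _ hT) hnN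
  have y3 : R * T * I.n ≤ Y := Nat.mul_le_mul_left _ hn3
  have y4 : R * I.n ≤ Y := Nat.mul_le_mul (Nat.le_mul_of_pos_right _ hT) hn3
  have y5 : I.n ≤ Y := (Nat.le_mul_of_pos_left _ hR1).trans y4
  have y6 := Nat.mul_le_mul_left M y3
  have y7 := Nat.mul_le_mul_left M y4
  nlinarith

end SecludedProgram

/-! ### The running time -/

theorem RamExec.one_le {p : RamProg} {s s' : RamState} {m : ℕ} (h : RamExec p s s' m) : 1 ≤ m := by
  induction h <;> omega

/-- A sequence of `k - 1` takings and `t` forbiddings is given by the positions of the rarer ones,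
so that the number of these sequences also satisfies the second running time bound. -/
theorem choose_le_add_pow_min (k t : ℕ) : (k - 1 + t).choose (k - 1) ≤ (k + t) ^ min k t := by
  rcases Nat.eq_zero_or_pos k with rfl | hk
  · simp
  rcases le_total k t with h | h
  · rw [min_eq_left h]
    calc (k - 1 + t).choose (k - 1) ≤ (k - 1 + t) ^ (k - 1) := Nat.choose_le_pow _ _
      _ ≤ (k + t) ^ (k - 1) := Nat.pow_le_pow_left (by omega) _
      _ ≤ (k + t) ^ k := Nat.pow_le_pow_right (by omega) (by omega)
  · rw [min_eq_right h, Nat.choose_symm_add]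
    exact (Nat.choose_le_pow _ _).trans (Nat.pow_le_pow_left (by omega) _)

theorem add_pow_min_le_two_rpow (k t : ℕ) :
    (((k + t) ^ min k t : ℕ) : ℝ) ≤
      (2 : ℝ) ^ ((3 : ℝ) * ((min k t : ℕ) : ℝ) * Real.log ((k : ℝ) + (t : ℝ))) := by
  rcases Nat.eq_zero_or_pos (k + t) with h | h
  · obtain rfl : k = 0 := by omega
    simp
  have hpos : (0 : ℝ) < (k : ℝ) + (t : ℝ) := by exact_mod_cast h
  have hlog : 0 ≤ Real.log ((k : ℝ) + (t : ℝ)) := Real.log_nonneg (by exact_mod_cast h)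
  -- The factor `3` in the exponent suffices because `3 * Real.log 2 > 1`.
  have h2 := Real.log_two_gt_d9
  rw [Real.rpow_def_of_pos (by norm_num), Nat.cast_pow, ← Real.rpow_natCast, Nat.cast_add,
    Real.rpow_def_of_pos hpos]
  refine Real.exp_le_exp.2 ?_
  have h3 : 0 ≤ Real.log ((k : ℝ) + (t : ℝ)) * ((min k t : ℕ) : ℝ) := by positivity
  nlinarith

theorem mainTheorem3 :
    ∃ C : ℕ, ∀ (P : ColoredGraphProperty) (f : ℕ → ℝ), P.RecognizableInTime f →
      (∃ A : ℝ, SecludedSolvableInTime P fun I =>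
        A * (2 : ℝ) ^ (I.k + I.t) * f I.k * ((I.n : ℝ) + 1) ^ C) ∧
      (∃ A : ℝ, SecludedSolvableInTime P fun I =>
        A * (2 : ℝ) ^ ((C : ℝ) * ((min I.k I.t : ℕ) : ℝ) * Real.log ((I.k : ℝ) + (I.t : ℝ))) *
          f I.k * ((I.n : ℝ) + 1) ^ C) := by
  refine ⟨3, fun P f ⟨p, hp⟩ => ?_⟩
  obtain ⟨M, hM, hMr, hMa⟩ := SecludedProgram.exists_mod_lt p
  -- The time bound of the recognizer is positive since every run takes at least one step.
  have hf : ∀ k, 1 ≤ f k := fun k => by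
    obtain ⟨s, m, h1, h2, -⟩ := hp ⟨k, ⊥, fun _ => 0⟩
    have h3 : (1 : ℝ) ≤ m := by exact_mod_cast h1.one_le
    exact h3.trans h2
  have key : ∀ I : SecludedInstance, ∃ (s : RamState) (m : ℕ),
      RamExec (SecludedProgram.solve p M) I.encode s m ∧
      (m : ℝ) ≤ (1000 + 10 * M : ℝ) * ((I.k - 1 + I.t).choose (I.k - 1) : ℕ) * f I.k *
        ((I.n : ℝ) + 1) ^ 3 ∧ (s.reg 0 ≠ 0 ↔ I.IsYes P) := by
    intro I
    have hrec : SecludedProgram.Recognizer P p M I.k ⌊f I.k⌋₊ := by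
      refine ⟨hM, hMr, hMa, fun X hX => ?_⟩
      obtain ⟨s, m, h1, h2, h3⟩ := hp X
      simp only [hX] at h2
      exact ⟨s, m, h1, Nat.le_floor h2, h3⟩
    obtain ⟨s, m, h1, h2, h3⟩ := SecludedProgram.solve_runs hrec (Nat.floor_pos.2 (hf I.k))
    refine ⟨s, m, h1, ?_, h3⟩
    have hmono : (I.k - 1 + min I.t I.n).choose (I.k - 1) ≤ (I.k - 1 + I.t).choose (I.k - 1) :=
      Nat.choose_le_choose _ (by omega)
    have h4 : (m : ℝ) ≤ (1000 + 10 * M : ℝ) *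
        (((I.k - 1 + min I.t I.n).choose (I.k - 1) : ℕ) * (⌊f I.k⌋₊ : ℝ) * ((I.n : ℝ) + 1) ^ 3) := by
      exact_mod_cast h2
    have hf0 : 0 ≤ f I.k := zero_le_one.trans (hf I.k)
    calc (m : ℝ) ≤ _ := h4
      _ ≤ (1000 + 10 * M : ℝ) * (((I.k - 1 + I.t).choose (I.k - 1) : ℕ) * f I.k *
          ((I.n : ℝ) + 1) ^ 3) := by
        gcongr
        exact Nat.floor_le hf0
      _ = _ := by ring
  have bound : ∀ (I : SecludedInstance) (m : ℕ) (B : ℝ),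
      (((I.k - 1 + I.t).choose (I.k - 1) : ℕ) : ℝ) ≤ B →
      (m : ℝ) ≤ (1000 + 10 * M : ℝ) * ((I.k - 1 + I.t).choose (I.k - 1) : ℕ) * f I.k *
        ((I.n : ℝ) + 1) ^ 3 →
      (m : ℝ) ≤ (1000 + 10 * M : ℝ) * B * f I.k * ((I.n : ℝ) + 1) ^ 3 := fun I m B hB h => by
    have := zero_le_one.trans (hf I.k)
    refine h.trans ?_
    gcongr
  refine ⟨⟨1000 + 10 * M, SecludedProgram.solve p M, fun I => ?_⟩,
    ⟨1000 + 10 * M, SecludedProgram.solve p M, fun I => ?_⟩⟩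
  · obtain ⟨s, m, h1, h2, h3⟩ := key I
    refine ⟨s, m, h1, bound I m _ ?_ h2, h3⟩
    have h4 : (I.k - 1 + I.t).choose (I.k - 1) ≤ 2 ^ (I.k + I.t) :=
      (Nat.choose_le_two_pow _ _).trans (Nat.pow_le_pow_right (by norm_num) (by omega))
    exact_mod_cast h4
  · obtain ⟨s, m, h1, h2, h3⟩ := key I
    refine ⟨s, m, h1, bound I m _ ?_ h2, h3⟩
    refine le_trans ?_ (add_pow_min_le_two_rpow I.k I.t)
    exact_mod_cast choose_le_add_pow_min I.k I.t
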